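/- **Setting.** All manifolds and maps are smooth; manifolds are finite-dimensional and without boundary. Let $(P,\pi,M,H)$ be a principal $H$-bundle with right action $R:P\times H\to P$, let $G\subset H$ be an (embedded) Lie subgroup, and let $Q\subset P$ be a principal $G$-subbundle, i.e. an embedded submanifold of $P$ which is a principal $G$-bundle over $M$ for the restriction of $\pi$ and of the right action. Let $\mathfrak h,\mathfrak g$ be the Lie algebras of $H,G$, and let $\mathfrak h=\mathfrak g\oplus\mathfrak m$ be a splitting into linear subspaces which is invariant under $\mathrm{Ad}(G)$, with projections $pr_{\mathfrak g}, pr_{\mathfrak m}:\mathfrak h\to\mathfrak h$. Let $h\in C^\infty(M,H)$ take values in the normaliser $N_H(G)=\{a\in H : aGa^{-1}=G\}$, let $\mathcal R_h:P\to P$, $p\mapsto R_{h(\pi(p))}p$, and let $Q'=\mathcal R_h(Q)\subset P$, an embedded submanifold with the right action of $G$ restricted from $P$. Write $\mu_H\in\Omega^1(H,\mathfrak h)$ for the left-invariant Maurer--Cartan form of $H$, and $\mathcal C(P)$, $\mathcal C(Q)$, $\mathcal C(Q')$ for the sets of connection $1$-forms (smooth Lie-algebra-valued $1$-forms $A$ with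 $R_a^*A=\mathrm{Ad}(a^{-1})\circ A$ that map each fundamental vector to its generator), with structure groups $H$, $G$, $G$ respectively. **Proposition.** Each $A\in\mathcal C(Q)$ extends to a unique connection $\widehat f_Q(A)\in\mathcal C(P)$, and each $A'\in\mathcal C(Q')$ extends to a unique connection $\widehat f_{Q'}(A')\in\mathcal C(P)$. The assignment $f_{Q,h}(A)=pr_{\mathfrak g}\circ \widehat f_Q(A)|_{Q'}$ defines a bijection $f_{Q,h}:\mathcal C(Q)\to\mathcal C(Q')$. There is a unique smooth $1$-form $\zeta_h\in\Omega^1(P,\mathfrak h)$ which is horizontal (it vanishes on the vectors in $\ker d\pi$), of type $\mathrm{Ad}$ ($R_a^*\zeta_h=\mathrm{Ad}(a^{-1})\circ\zeta_h$ for all $a\in H$), and satisfies $$s'^*\zeta_h=pr_{\mathfrak m}\circ h^*\mu_H$$ on $U$ for every open $U\subset M$ and every smooth local section $s'\in\Gamma(U,Q')$. For every $A\in\mathcal C(Q)$, $$\widehat f_Q(A)-f_{Q,h}(A)=\zeta_h\quad\text{on } P,$$ where $f_{Q,h}(A)$ is identified with its extension $\widehat f_{Q'}(f_{Q,h}(A))\in\mathcal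 C(P)$. Moreover, for every $A\in\mathcal C(Q)$, every open $U\subset M$ and every smooth local section $s\in\Gamma(U,Q)$, $s'=\mathcal R_h\circ s$ is a smooth local section of $Q'$ over $U$, and $$s'^*f_{Q,h}(A)=\mathrm{Ad}(h^{-1})\circ s^*A+pr_{\mathfrak g}\circ h^*\mu_H\quad\text{on } U.$$ -/

import Mathlib

open scoped Manifold ContDiff
open MulOpposite

/-!
Manifolds are smooth, without boundary and finite dimensional: charted spaces over a
finite-dimensional real normed space `E`, with model `𝓘(ℝ, E)` and smoothness `∞`.
Right actions of a group `G` on `Y` are actions of `Gᵐᵒᵖ`, so that `op g • y` is `y · g`.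
Mathlib's tangent spaces `TangentSpace 𝓘(ℝ, E) x` are by definition copies of the model space `E`;
`GroupLieAlgebra 𝓘(ℝ, E) G` is the tangent space of the Lie group `G` at `1`.
-/

noncomputable section

namespace NormalDeformation

section LieGroups

variable {E : Type*} [NormedAddCommGroup E] [NormedSpace ℝ E]
  {H : Type*} [TopologicalSpace H] [ChartedSpace E H] [Group H]

/-- The adjoint representation: `Ad a` is the derivative at `1` of `x ↦ a x a⁻¹`. -/
def Ad (a : H) : GroupLieAlgebra 𝓘(ℝ, E) H →L[ℝ] GroupLieAlgebra 𝓘(ℝ, E) H :=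
  mfderiv 𝓘(ℝ, E) 𝓘(ℝ, E) (fun x : H => a * x * a⁻¹) 1

/-- The (left-invariant) Maurer-Cartan form: at `a` it is the derivative at `a` of `x ↦ a⁻¹ x`. -/
def maurerCartan (a : H) : TangentSpace 𝓘(ℝ, E) a →L[ℝ] GroupLieAlgebra 𝓘(ℝ, E) H :=
  mfderiv 𝓘(ℝ, E) 𝓘(ℝ, E) (fun x : H => a⁻¹ * x) a

variable {EG : Type*} [NormedAddCommGroup EG] [NormedSpace ℝ EG]
  {G : Type*} [TopologicalSpace G] [ChartedSpace EG G] [Group G]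

/-- The Lie algebra homomorphism `𝔤 → 𝔥` induced by a homomorphism of Lie groups `G → H`. -/
def lieMap (ι : G →* H) : GroupLieAlgebra 𝓘(ℝ, EG) G →L[ℝ] GroupLieAlgebra 𝓘(ℝ, E) H :=
  mfderiv 𝓘(ℝ, EG) 𝓘(ℝ, E) ι 1

/-- The Lie algebra of `G`, viewed as a linear subspace of `𝔥`, for a Lie subgroup `ι : G → H`. -/
def lieSubspace (ι : G →* H) : Submodule ℝ (GroupLieAlgebra 𝓘(ℝ, E) H) :=
  LinearMap.range (lieMap (E := E) (EG := EG) ι).toLinearMap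

end LieGroups

section Forms

variable (EP : Type*) [NormedAddCommGroup EP] [NormedSpace ℝ EP]
  (P : Type*) [TopologicalSpace P] [ChartedSpace EP P] [IsManifold 𝓘(ℝ, EP) ∞ P]
  (EH : Type*) [NormedAddCommGroup EH] [NormedSpace ℝ EH]
  (H : Type*) [TopologicalSpace H] [ChartedSpace EH H] [Group H]

/-- Smooth `1`-forms on `P` with values in the Lie algebra of `H`, i.e. fibrewise linear maps
`TP → 𝔥` which are smooth on the total space of the tangent bundle. -/
@[ext]
structure LieForm where
  form : ∀ p : P, TangentSpace 𝓘(ℝ, EP) p →L[ℝ] GroupLieAlgebra 𝓘(ℝ, EH) H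
  smooth : ContMDiff (𝓘(ℝ, EP).tangent) 𝓘(ℝ, EH) (M' := EH) ∞
    (fun v : TangentBundle 𝓘(ℝ, EP) P => (form v.1 v.2 : EH))

variable {EP P EH H}
variable [MulAction Hᵐᵒᵖ P]

/-- The derivative of the right translation `R_a : p ↦ p · a`. -/
def rightDeriv (a : H) (p : P) :
    TangentSpace 𝓘(ℝ, EP) p →L[ℝ] TangentSpace 𝓘(ℝ, EP) (op a • p) :=
  mfderiv 𝓘(ℝ, EP) 𝓘(ℝ, EP) (fun y : P => op a • y) p

/-- The fundamental vector at `p` generated by `X ∈ 𝔥`, the derivative at `1` of `a ↦ p · a`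
applied to `X`. -/
def fundamentalVector (X : GroupLieAlgebra 𝓘(ℝ, EH) H) (p : P) : TangentSpace 𝓘(ℝ, EP) p :=
  mfderiv 𝓘(ℝ, EH) 𝓘(ℝ, EP) (fun a : H => op a • p) 1 X

/-- `α` is of type `Ad`: `R_a^* α = Ad(a⁻¹) ∘ α` for all `a`. -/
def LieForm.IsTypeAd (α : LieForm EP P EH H) : Prop :=
  ∀ (a : H) (p : P) (v : TangentSpace 𝓘(ℝ, EP) p),
    α.form (op a • p) (rightDeriv a p v) = Ad (E := EH) a⁻¹ (α.form p v)

variable (EP P EH H) in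
/-- Connection `1`-forms on `P` with structure group `H`: smooth `𝔥`-valued `1`-forms of type `Ad`
that send each fundamental vector to its generator. -/
structure Connection extends LieForm EP P EH H where
  isTypeAd : toLieForm.IsTypeAd
  apply_fundamentalVector : ∀ (X : GroupLieAlgebra 𝓘(ℝ, EH) H) (p : P),
    form p (fundamentalVector X p) = X

variable {EM : Type*} [NormedAddCommGroup EM] [NormedSpace ℝ EM]
  {M : Type*} [TopologicalSpace M] [ChartedSpace EM M]

variable (EM) in
/-- `α` is horizontal with respect to `π`: it vanishes on vertical vectors. -/
def LieForm.IsHorizontal (π : P → M) (α : LieForm EP P EH H) : Prop :=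
  ∀ (p : P) (v : TangentSpace 𝓘(ℝ, EP) p),
    mfderiv 𝓘(ℝ, EP) 𝓘(ℝ, EM) π p v = 0 → α.form p v = 0

end Forms

section Bundles

variable (EP : Type*) [NormedAddCommGroup EP] [NormedSpace ℝ EP]
  {P : Type*} [TopologicalSpace P] [ChartedSpace EP P]
  (EH : Type*) [NormedAddCommGroup EH] [NormedSpace ℝ EH]
  (H : Type*) [TopologicalSpace H] [ChartedSpace EH H] [Group H] [MulAction Hᵐᵒᵖ P]
  (EM : Type*) [NormedAddCommGroup EM] [NormedSpace ℝ EM]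
  {M : Type*} [TopologicalSpace M] [ChartedSpace EM M]

/-- `(P, π, M, H)` is a smooth principal bundle: the right action and `π` are smooth, the
action preserves the fibres of `π`, and `M` is covered by the base sets of smooth,
`H`-equivariant local trivialisations `π⁻¹(U) ≃ U × H`. -/
structure IsPrincipalBundle (π : P → M) : Prop where
  smooth_proj : ContMDiff 𝓘(ℝ, EP) 𝓘(ℝ, EM) ∞ π
  smooth_action : ContMDiff (𝓘(ℝ, EP).prod 𝓘(ℝ, EH)) 𝓘(ℝ, EP) ∞
    (fun z : P × H => op z.2 • z.1)
  proj_smul : ∀ (a : H) (p : P), π (op a • p) = π p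
  locallyTrivial : ∀ x : M, ∃ e : Bundle.Trivialization H π, x ∈ e.baseSet ∧
    ContMDiffOn 𝓘(ℝ, EP) (𝓘(ℝ, EM).prod 𝓘(ℝ, EH)) ∞ e e.source ∧
    ContMDiffOn (𝓘(ℝ, EM).prod 𝓘(ℝ, EH)) 𝓘(ℝ, EP) ∞ e.toOpenPartialHomeomorph.symm e.target ∧
    ∀ p ∈ e.source, ∀ a : H, e (op a • p) = ((e p).1, (e p).2 * a)

variable (EQ : Type*) [NormedAddCommGroup EQ] [NormedSpace ℝ EQ]
  {Q : Type*} [TopologicalSpace Q] [ChartedSpace EQ Q]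
  (EG : Type*) [NormedAddCommGroup EG] [NormedSpace ℝ EG]
  {G : Type*} [TopologicalSpace G] [ChartedSpace EG G] [Group G] [MulAction Gᵐᵒᵖ Q]

variable {H}

/-- `j : Q → P` exhibits `Q` as an embedded submanifold of `P` on which the right action of `G` is
the restriction of the right action of `H ⊇ G` on `P`. -/
structure IsInvariantSubmanifold (ι : G →* H) (j : Q → P) : Prop where
  embedding : Manifold.IsSmoothEmbedding 𝓘(ℝ, EQ) 𝓘(ℝ, EP) ∞ j
  map_smul : ∀ (g : G) (q : Q), j (op g • q) = op (ι g) • j q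

/-- `j : Q → P` exhibits `Q` as a principal `G`-subbundle of `(P, π, M, H)`. -/
structure IsPrincipalSubbundle (π : P → M) (ι : G →* H) (j : Q → P) : Prop
    extends IsInvariantSubmanifold EP EQ ι j where
  isPrincipalBundle : IsPrincipalBundle EQ EG G EM (fun q => π (j q))

/-- `s` is a smooth local section over the open set `U` of `π : Q → M`. -/
structure IsLocalSection (π : Q → M) (U : Set M) (s : M → Q) : Prop where
  isOpen : IsOpen U
  smooth : ContMDiffOn 𝓘(ℝ, EM) 𝓘(ℝ, EQ) ∞ s U
  proj : ∀ x ∈ U, π (s x) = x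

end Bundles

/-- The map `𝓡_h : P → P`, `p ↦ p · h(π(p))`. -/
def deform {P M H : Type*} [Group H] [MulAction Hᵐᵒᵖ P] (π : P → M) (h : M → H) (p : P) : P :=
  op (h (π p)) • p

section Restriction

variable {EP : Type*} [NormedAddCommGroup EP] [NormedSpace ℝ EP]
  {P : Type*} [TopologicalSpace P] [ChartedSpace EP P] [IsManifold 𝓘(ℝ, EP) ∞ P]
  {EH : Type*} [NormedAddCommGroup EH] [NormedSpace ℝ EH]
  {H : Type*} [TopologicalSpace H] [ChartedSpace EH H] [Group H] [MulAction Hᵐᵒᵖ P]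
  {EQ : Type*} [NormedAddCommGroup EQ] [NormedSpace ℝ EQ]
  {Q : Type*} [TopologicalSpace Q] [ChartedSpace EQ Q] [IsManifold 𝓘(ℝ, EQ) ∞ Q]
  {EG : Type*} [NormedAddCommGroup EG] [NormedSpace ℝ EG]
  {G : Type*} [TopologicalSpace G] [ChartedSpace EG G] [Group G] [MulAction Gᵐᵒᵖ Q]

/-- The connection `B` on `P` extends the connection `A` on `Q`: `j^* B = A`, where `𝔤 ⊆ 𝔥`. -/
def Extends (ι : G →* H) (j : Q → P) (A : Connection EQ Q EG G) (B : Connection EP P EH H) :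
    Prop :=
  ∀ (q : Q) (ξ : TangentSpace 𝓘(ℝ, EQ) q),
    B.form (j q) (mfderiv 𝓘(ℝ, EQ) 𝓘(ℝ, EP) j q ξ) = lieMap (E := EH) (EG := EG) ι (A.form q ξ)

/-- `A = pr_𝔤 ∘ B|_Q`, for the projection `pr_𝔤` of `𝔥` onto `𝔤` along a complement `𝔪`. -/
def IsProjectedRestriction (ι : G →* H) (𝔪 : Submodule ℝ (GroupLieAlgebra 𝓘(ℝ, EH) H))
    (h𝔪 : IsCompl (lieSubspace (E := EH) (EG := EG) ι) 𝔪) (j : Q → P)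
    (B : Connection EP P EH H) (A : Connection EQ Q EG G) : Prop :=
  ∀ (q : Q) (ξ : TangentSpace 𝓘(ℝ, EQ) q),
    lieMap (E := EH) (EG := EG) ι (A.form q ξ) =
      Submodule.projection _ 𝔪 h𝔪 (B.form (j q) (mfderiv 𝓘(ℝ, EQ) 𝓘(ℝ, EP) j q ξ))

variable {EM : Type*} [NormedAddCommGroup EM] [NormedSpace ℝ EM]
  {M : Type*} [TopologicalSpace M] [ChartedSpace EM M]

variable (EQ EM) in
/-- `ζ` is a horizontal `𝔥`-valued `1`-form of type `Ad` on `P` such that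
`s'^* ζ = pr_𝔪 ∘ h^* μ_H` for every local section `s'` of the subbundle `j' : Q' → P`. -/
structure IsDeformationForm (π : P → M) (h : M → H) (j' : Q → P)
    (𝔤 𝔪 : Submodule ℝ (GroupLieAlgebra 𝓘(ℝ, EH) H)) (h𝔪 : IsCompl 𝔤 𝔪)
    (ζ : LieForm EP P EH H) : Prop where
  isHorizontal : ζ.IsHorizontal EM π
  isTypeAd : ζ.IsTypeAd
  localRep : ∀ (U : Set M) (s' : M → Q), IsLocalSection EM EQ (fun q => π (j' q)) U s' →
    ∀ x ∈ U, ∀ v : TangentSpace 𝓘(ℝ, EM) x,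
      ζ.form (j' (s' x)) (mfderiv 𝓘(ℝ, EM) 𝓘(ℝ, EP) (fun y => j' (s' y)) x v) =
        Submodule.projection 𝔪 𝔤 h𝔪.symm
          (maurerCartan (h x) (mfderiv 𝓘(ℝ, EM) 𝓘(ℝ, EH) h x v))

end Restriction

end NormalDeformation

end

/-! A form of type `Ad` on `P` whose value on fundamental vectors is `c` times the generator is
determined by its values along local sections: near a fibre `p = t(π p) · τ(p)`, and the product
rule gives `α = Ad(τ⁻¹) ∘ π^*(t^*α) + c · τ^*μ_H`. Conversely, local forms obeying the corresponding
rule under change of section glue to a form on `P`. The case `c = 1` covers connections and `c = 0`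
horizontal forms, so one uniqueness lemma (`IsReduction.lieForm_ext`) and one gluing lemma
(`IsReduction.exists_lieForm`) produce both extensions and the form `ζ`. They need only local
sections of the submanifold and fibres that are `G`-orbits (`IsReduction`); `Q'` inherits these from
`Q` because `h` normalises `G` (`IsReduction.of_deform`).

For `ζ`, the local form is `pr_𝔪 ∘ h^*μ_H` for every section, so it must be fixed by `Ad(G)`.
Computing the logarithmic derivative of `h g = (h g h⁻¹) h` in two ways, with `h g h⁻¹` valued in
`G`, shows that `Ad(g⁻¹)` fixes `h^*μ_H` modulo `𝔤` (`Ad_maurerCartan_sub_mem`). Since `pr_𝔪`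
commutes with `Ad(G)`, this suffices.

Along `s' = s · h`, the extension of `A` equals `Ad(h⁻¹) s^*A + h^*μ_H`. The first term is in `𝔤`,
again by the normaliser condition. The `𝔤`-part is therefore the stated formula for `f(A)`, and the
`𝔪`-part is `pr_𝔪 ∘ h^*μ_H`; uniqueness gives `fhat A = fhat' (f A) + ζ`. Injectivity of `f` follows
at once. For surjectivity, `fhat' A' + ζ` is `𝔤`-valued along sections of `Q`, hence is itself the
extension of a connection on `Q`. -/

noncomputable section

namespace NormalDeformation

/-! ### Smooth embeddings and tangent maps -/

open scoped Topology

section Calculus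

open Bundle

variable {EN HN : Type*} [NormedAddCommGroup EN] [NormedSpace ℝ EN] [TopologicalSpace HN]
  {IN : ModelWithCorners ℝ EN HN} {N : Type*} [TopologicalSpace N] [ChartedSpace HN N]
  {EK : Type*} [NormedAddCommGroup EK] [NormedSpace ℝ EK]
  {K : Type*} [TopologicalSpace K] [ChartedSpace EK K]
  {EL : Type*} [NormedAddCommGroup EL] [NormedSpace ℝ EL]
  {L : Type*} [TopologicalSpace L] [ChartedSpace EL L]

/-- A map into an embedded submanifold is smooth where its composition with the embedding is. -/
theorem contMDiffAt_of_comp_embedding [IsManifold 𝓘(ℝ, EK) ∞ K] [IsManifold 𝓘(ℝ, EL) ∞ L]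
    [IsManifold IN ∞ N] {j : K → L}
    (hj : Manifold.IsSmoothEmbedding 𝓘(ℝ, EK) 𝓘(ℝ, EL) ∞ j) {u : N → K} {n : N}
    (hu : ContMDiffAt IN 𝓘(ℝ, EL) ∞ (fun x => j (u x)) n) :
    ContMDiffAt IN 𝓘(ℝ, EK) ∞ u n :=
  (ContMDiffAt.iff_comp_isImmersionAt (hj.isImmersion.isImmersionAt (u n))).2
    ⟨hj.isEmbedding.isInducing.continuousAt_iff.2 hu.continuousAt, hu⟩

/-- The derivative of a smooth embedding is injective. -/
theorem mfderiv_embedding_injective [IsManifold 𝓘(ℝ, EK) ∞ K] [IsManifold 𝓘(ℝ, EL) ∞ L] {j : K → L}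
    (hj : Manifold.IsSmoothEmbedding 𝓘(ℝ, EK) 𝓘(ℝ, EL) ∞ j) (x : K) :
    Function.Injective (mfderiv 𝓘(ℝ, EK) 𝓘(ℝ, EL) j x) := by
  have h := hj.isImmersion.isImmersionAt x
  set φ := h.domChart
  set ψ := h.codChart
  -- In immersion charts `j` is `v ↦ (v, 0)`, so taking the first component gives a smooth local
  -- left inverse of `j`.
  set r : L → K := fun y => φ.symm (h.equiv.symm (ψ y)).1 with hr
  have key : ∀ y ∈ φ.source, (h.equiv.symm (ψ (j y))).1 = φ y := by
    intro y hy
    have := h.writtenInCharts (show φ y ∈ (φ.extend 𝓘(ℝ, EK)).target by simpa using φ.map_source hy)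
    simp only [Function.comp_apply] at this
    have h2 : (φ.extend 𝓘(ℝ, EK)).symm (φ y) = y := by simpa using φ.left_inv hy
    erw [h2] at this
    have h3 : ψ (j y) = h.equiv (φ y, 0) := this
    rw [h3]; simp
  have hx : x ∈ φ.source := h.mem_domChart_source
  have hrj : (fun y => r (j y)) =ᶠ[𝓝 x] id := by
    filter_upwards [φ.open_source.mem_nhds hx] with y hy
    simp only [hr, key y hy, id, φ.left_inv hy]
  have hψ : ContMDiffAt 𝓘(ℝ, EL) 𝓘(ℝ, EL) ∞ ψ (j x) :=
    (contMDiffOn_of_mem_maximalAtlas h.codChart_mem_maximalAtlas).contMDiffAt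
      (ψ.open_source.mem_nhds h.mem_codChart_source)
  have hφ : ContMDiffAt 𝓘(ℝ, EK) 𝓘(ℝ, EK) ∞ φ.symm (h.equiv.symm (ψ (j x))).1 := by
    rw [key x hx]
    exact (contMDiffOn_symm_of_mem_maximalAtlas h.domChart_mem_maximalAtlas).contMDiffAt
      (φ.open_target.mem_nhds (φ.map_source hx))
  have hl : ContMDiff 𝓘(ℝ, EL) 𝓘(ℝ, EK) ∞ (fun v => (h.equiv.symm v).1) :=
    ((ContinuousLinearMap.fst ℝ _ _).comp
      (h.equiv.symm : EL →L[ℝ] EK × h.complement)).contDiff.contMDiff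
  have hr' : MDifferentiableAt 𝓘(ℝ, EL) 𝓘(ℝ, EK) r (j x) :=
    (hφ.comp (j x) (hl.contMDiffAt.comp (j x) hψ)).mdifferentiableAt (by simp)
  have hd := mfderiv_comp x hr' (hj.contMDiff.contMDiffAt.mdifferentiableAt (by simp))
  have hd' : mfderiv 𝓘(ℝ, EK) 𝓘(ℝ, EK) (fun y => r (j y)) x = mfderiv 𝓘(ℝ, EK) 𝓘(ℝ, EK) id x :=
    hrj.mfderiv_eq
  intro v w hvw
  have e : ∀ u, mfderiv 𝓘(ℝ, EL) 𝓘(ℝ, EK) r (j x) (mfderiv 𝓘(ℝ, EK) 𝓘(ℝ, EL) j x u) = u := by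
    intro u
    have := congrArg (fun T => T u) (hd.symm.trans hd')
    rw [mfderiv_id] at this
    exact this
  rw [← e v, ← e w, hvw]

/-- Partial tangent maps of a smooth map of two variables are jointly smooth. -/
theorem contMDiff_partialTangentMap {EN N : Type*} [NormedAddCommGroup EN] [NormedSpace ℝ EN]
    [TopologicalSpace N] [ChartedSpace EN N] [IsManifold 𝓘(ℝ, EN) ∞ N]
    [IsManifold 𝓘(ℝ, EK) ∞ K] [IsManifold 𝓘(ℝ, EL) ∞ L] {f : N × K → L}
    (hf : ContMDiff (𝓘(ℝ, EN).prod 𝓘(ℝ, EK)) 𝓘(ℝ, EL) ∞ f) :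
    ContMDiff (𝓘(ℝ, EN).prod 𝓘(ℝ, EK).tangent) 𝓘(ℝ, EL).tangent ∞
      (fun z : N × TangentBundle 𝓘(ℝ, EK) K =>
        (⟨f (z.1, z.2.1), mfderiv 𝓘(ℝ, EK) 𝓘(ℝ, EL) (fun k => f (z.1, k)) z.2.1 z.2.2⟩ :
          TangentBundle 𝓘(ℝ, EL) L)) := by
  have _ : IsManifold 𝓘(ℝ, EN) 1 N := .of_le (n := ∞) (by simp)
  have _ : IsManifold 𝓘(ℝ, EK) 1 K := .of_le (n := ∞) (by simp)
  have _ : IsManifold 𝓘(ℝ, EL) 1 L := .of_le (n := ∞) (by simp)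
  -- The partial derivative in `K` is the full derivative on vectors with zero component along `N`,
  -- so the zero section of `TN` is inserted.
  have S₁ : ContMDiff (𝓘(ℝ, EN).prod 𝓘(ℝ, EK).tangent) (𝓘(ℝ, EN).tangent.prod 𝓘(ℝ, EK).tangent) ∞
      (fun z : N × TangentBundle 𝓘(ℝ, EK) K =>
        ((TotalSpace.mk' EN z.1 0 : TangentBundle 𝓘(ℝ, EN) N), z.2)) :=
    ((contMDiff_zeroSection ℝ (TangentSpace 𝓘(ℝ, EN) (M := N))).comp contMDiff_fst).prodMk
      contMDiff_snd
  have S₃ := hf.contMDiff_tangentMap (m := ∞) (by simp)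
  have S := (S₃.comp contMDiff_equivTangentBundleProd_symm).comp S₁
  refine S.congr fun z => ?_
  refine congrArg (TotalSpace.mk' EL (E := TangentSpace 𝓘(ℝ, EL)) (f (z.1, z.2.1))) ?_
  let w : EN × EK := (0, z.2.2)
  have e := mfderiv_prod_eq_add_apply (p := (z.1, z.2.1)) (v := w)
    (hf.mdifferentiable (by simp) (z.1, z.2.1))
  have e0 : mfderiv 𝓘(ℝ, EN) 𝓘(ℝ, EL) (fun z' : N => f (z', z.2.1)) z.1 w.1 = 0 := map_zero _
  rw [e0, zero_add] at e
  exact e.symm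

/-- The fibre part of a smooth map into one fibre of the tangent bundle is smooth. -/
theorem contMDiff_snd_of_proj_eq [IsManifold 𝓘(ℝ, EL) ∞ L] {g : N → TangentBundle 𝓘(ℝ, EL) L}
    (l : L) (hg : ContMDiff IN 𝓘(ℝ, EL).tangent ∞ g) (hl : ∀ n, (g n).1 = l) :
    ContMDiff IN 𝓘(ℝ, EL) (M' := EL) ∞ (fun n => ((g n).2 : EL)) := by
  have _ : IsManifold 𝓘(ℝ, EL) 1 L := .of_le (n := ∞) (by simp)
  intro n
  have := (contMDiffAt_totalSpace.1 (hg n)).2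
  refine this.congr_of_eventuallyEq (.of_forall fun m => ?_)
  -- The trivialisation centred at `l` is the identity on the fibre over `l` itself.
  have key : ∀ w : TangentBundle 𝓘(ℝ, EL) L, w.1 = l →
      w.2 = (trivializationAt EL (TangentSpace 𝓘(ℝ, EL)) l w).2 := by
    rintro ⟨w₁, w₂⟩ rfl
    exact (tangentCoordChange_self (I := 𝓘(ℝ, EL)) (E := EL) (v := w₂)
      (mem_extChartAt_source w₁)).symm
  rw [hl n]
  exact key _ (hl m)

/-- The inclusion of a fibre into the tangent bundle is smooth. -/
theorem contMDiff_fiberInclusion [IsManifold 𝓘(ℝ, EL) ∞ L] (l : L) :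
    ContMDiff 𝓘(ℝ, EL) 𝓘(ℝ, EL).tangent ∞
      (fun X : EL => (⟨l, X⟩ : TangentBundle 𝓘(ℝ, EL) L)) := by
  have _ : IsManifold 𝓘(ℝ, EL) 1 L := .of_le (n := ∞) (by simp)
  intro X
  refine contMDiffAt_totalSpace.2 ⟨contMDiffAt_const, ?_⟩
  refine (contMDiff_id (I := 𝓘(ℝ, EL)) X).congr_of_eventuallyEq (.of_forall fun Y => ?_)
  exact tangentCoordChange_self (I := 𝓘(ℝ, EL)) (E := EL) (v := Y) (mem_extChartAt_source l)

/-- The chain rule, at a point whose image is given by a propositional equality. -/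
theorem mfderiv_comp_apply_eq {EN N : Type*} [NormedAddCommGroup EN] [NormedSpace ℝ EN]
    [TopologicalSpace N] [ChartedSpace EN N] {g : K → L} {f : N → K} {x : N} {y : K}
    (hg : MDifferentiableAt 𝓘(ℝ, EK) 𝓘(ℝ, EL) g y) (hf : MDifferentiableAt 𝓘(ℝ, EN) 𝓘(ℝ, EK) f x)
    (hy : f x = y) (v : TangentSpace 𝓘(ℝ, EN) x) :
    mfderiv 𝓘(ℝ, EN) 𝓘(ℝ, EL) (fun z => g (f z)) x v =
      mfderiv 𝓘(ℝ, EK) 𝓘(ℝ, EL) g y (mfderiv 𝓘(ℝ, EN) 𝓘(ℝ, EK) f x v) := by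
  subst hy
  exact mfderiv_comp_apply x hg hf v

end Calculus

/-! ### The adjoint representation, the Maurer-Cartan form and the product rule -/

section LieGroups

open Bundle

variable {E : Type*} [NormedAddCommGroup E] [NormedSpace ℝ E]
  {H : Type*} [TopologicalSpace H] [ChartedSpace E H] [Group H]

theorem Ad_one (X : GroupLieAlgebra 𝓘(ℝ, E) H) : Ad (E := E) (1 : H) X = X := by
  have h : (fun x : H => 1 * x * 1⁻¹) = id := by ext x; simp
  unfold Ad
  rw [h, mfderiv_id]
  rfl

section Action

variable {EP : Type*} [NormedAddCommGroup EP] [NormedSpace ℝ EP]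
  {P : Type*} [TopologicalSpace P] [ChartedSpace EP P] [MulAction Hᵐᵒᵖ P]

theorem contMDiff_smul_right
    (hP : ContMDiff (𝓘(ℝ, EP).prod 𝓘(ℝ, E)) 𝓘(ℝ, EP) ∞ (fun z : P × H => op z.2 • z.1)) (p : P) :
    ContMDiff 𝓘(ℝ, E) 𝓘(ℝ, EP) ∞ (fun a : H => op a • p) :=
  hP.comp (contMDiff_const.prodMk contMDiff_id)

theorem contMDiff_smul_left
    (hP : ContMDiff (𝓘(ℝ, EP).prod 𝓘(ℝ, E)) 𝓘(ℝ, EP) ∞ (fun z : P × H => op z.2 • z.1)) (a : H) :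
    ContMDiff 𝓘(ℝ, EP) 𝓘(ℝ, EP) ∞ (fun p : P => op a • p) :=
  hP.comp (contMDiff_id.prodMk contMDiff_const)

end Action

variable [LieGroup 𝓘(ℝ, E) ∞ H]

theorem contMDiff_conj (a : H) : ContMDiff 𝓘(ℝ, E) 𝓘(ℝ, E) ∞ (fun x : H => a * x * a⁻¹) :=
  (contMDiff_const.mul contMDiff_id).mul contMDiff_const

theorem Ad_mul (a b : H) (X : GroupLieAlgebra 𝓘(ℝ, E) H) :
    Ad (E := E) (a * b) X = Ad (E := E) a (Ad (E := E) b X) := by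
  have h : (fun x : H => a * b * x * (a * b)⁻¹) = fun x => a * (b * x * b⁻¹) * a⁻¹ := by
    ext x; group
  have := mfderiv_comp_apply_eq (g := fun x : H => a * x * a⁻¹) (y := 1)
    ((contMDiff_conj (E := E) a).mdifferentiable (by simp) _)
    ((contMDiff_conj (E := E) b).mdifferentiable (by simp) 1) (by simp) X
  rw [← h] at this
  exact this

theorem Ad_Ad_inv (a : H) (X : GroupLieAlgebra 𝓘(ℝ, E) H) :
    Ad (E := E) a (Ad (E := E) a⁻¹ X) = X := by
  rw [← Ad_mul, mul_inv_cancel, Ad_one]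

/-- Conjugation fixes `1`, so its partial tangent map at `1` stays in the single fibre over `1`,
where smoothness can be read off in the model space. -/
theorem contMDiff_Ad :
    ContMDiff (𝓘(ℝ, E).prod 𝓘(ℝ, E)) 𝓘(ℝ, E) (M := H × E) (M' := E) ∞
      (fun z => (Ad (E := E) z.1 z.2 : E)) := by
  have _ : IsManifold 𝓘(ℝ, E) 1 H := .of_le (n := ∞) (by simp)
  have h1 : ContMDiff (𝓘(ℝ, E).prod 𝓘(ℝ, E)) 𝓘(ℝ, E) ∞ (fun z : H × H => z.1 * z.2 * z.1⁻¹) :=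
    (contMDiff_fst.mul contMDiff_snd).mul contMDiff_fst.inv
  have h2 : ContMDiff 𝓘(ℝ, E) 𝓘(ℝ, E).tangent ∞
      (fun X : E => (⟨1, X⟩ : TangentBundle 𝓘(ℝ, E) H)) := contMDiff_fiberInclusion 1
  have h3 := (contMDiff_partialTangentMap h1).comp (contMDiff_fst.prodMk (h2.comp contMDiff_snd))
  exact contMDiff_snd_of_proj_eq (1 : H) h3 (fun z => by simp)

theorem contMDiff_maurerCartan :
    ContMDiff 𝓘(ℝ, E).tangent 𝓘(ℝ, E) (M' := E) ∞
      (fun v : TangentBundle 𝓘(ℝ, E) H => (maurerCartan v.1 v.2 : E)) := by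
  have _ : IsManifold 𝓘(ℝ, E) 1 H := .of_le (n := ∞) (by simp)
  have h1 : ContMDiff (𝓘(ℝ, E).prod 𝓘(ℝ, E)) 𝓘(ℝ, E) ∞ (fun z : H × H => z.1⁻¹ * z.2) :=
    contMDiff_fst.inv.mul contMDiff_snd
  have h3 := (contMDiff_partialTangentMap h1).comp
    ((contMDiff_proj (TangentSpace 𝓘(ℝ, E) (M := H))).prodMk contMDiff_id)
  exact contMDiff_snd_of_proj_eq (1 : H) h3 (fun z => by simp)

variable {EP : Type*} [NormedAddCommGroup EP] [NormedSpace ℝ EP]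
  {P : Type*} [TopologicalSpace P] [ChartedSpace EP P] [MulAction Hᵐᵒᵖ P]
  {EN : Type*} [NormedAddCommGroup EN] [NormedSpace ℝ EN]
  {N : Type*} [TopologicalSpace N] [ChartedSpace EN N]

/-- The product rule for `y ↦ t(y) · a(y)`. -/
theorem mfderiv_smul_apply
    (hP : ContMDiff (𝓘(ℝ, EP).prod 𝓘(ℝ, E)) 𝓘(ℝ, EP) ∞ (fun z : P × H => op z.2 • z.1))
    {a : N → H} {t : N → P} {n : N} (ha : MDifferentiableAt 𝓘(ℝ, EN) 𝓘(ℝ, E) a n)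
    (ht : MDifferentiableAt 𝓘(ℝ, EN) 𝓘(ℝ, EP) t n) (v : TangentSpace 𝓘(ℝ, EN) n) :
    mfderiv 𝓘(ℝ, EN) 𝓘(ℝ, EP) (fun y => op (a y) • t y) n v =
      rightDeriv (a n) (t n) (mfderiv 𝓘(ℝ, EN) 𝓘(ℝ, EP) t n v) +
        fundamentalVector (maurerCartan (a n) (mfderiv 𝓘(ℝ, EN) 𝓘(ℝ, E) a n v))
          (op (a n) • t n) := by
  have hd := hP.mdifferentiable (by simp) (t n, a n)
  let w : EP × E := (mfderiv 𝓘(ℝ, EN) 𝓘(ℝ, EP) t n v, mfderiv 𝓘(ℝ, EN) 𝓘(ℝ, E) a n v)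
  have h1 : mfderiv 𝓘(ℝ, EN) 𝓘(ℝ, EP) (fun y => op (a y) • t y) n v =
      mfderiv (𝓘(ℝ, EP).prod 𝓘(ℝ, E)) 𝓘(ℝ, EP) (fun z : P × H => op z.2 • z.1) (t n, a n) w := by
    refine (mfderiv_comp_apply n hd (ht.prodMk ha) v).trans ?_
    rw [mfderiv_prodMk ht ha]
    rfl
  have h2 := mfderiv_prod_eq_add_apply (p := (t n, a n)) (v := w) hd
  refine h1.trans (h2.trans (congrArg (HAdd.hAdd _) ?_))
  -- Rewriting the orbit map through `t n` as the orbit map through `t n · a n` after left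
  -- translation by `(a n)⁻¹` makes the Maurer-Cartan form appear.
  have h3 : (fun b : H => op b • t n) = fun b => op ((a n)⁻¹ * b) • op (a n) • t n := by
    ext b
    rw [smul_smul, ← op_mul, mul_inv_cancel_left]
  have h4 := mfderiv_comp_apply_eq (g := fun c : H => op c • op (a n) • t n)
    (f := fun b : H => (a n)⁻¹ * b) (y := 1)
    ((contMDiff_smul_right hP (op (a n) • t n)).mdifferentiable (by simp) 1)
    ((contMDiff_mul_left (I := 𝓘(ℝ, E)) (n := ∞)).mdifferentiable (by simp) (a n)) (by simp)
    (mfderiv 𝓘(ℝ, EN) 𝓘(ℝ, E) a n v)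
  rw [← h3] at h4
  exact h4

/-- A form of type `Ad` which multiplies generators by `c`, evaluated along `y ↦ t(y) · a(y)`. -/
theorem LieForm.form_mfderiv_smul [IsManifold 𝓘(ℝ, EP) ∞ P]
    (hP : ContMDiff (𝓘(ℝ, EP).prod 𝓘(ℝ, E)) 𝓘(ℝ, EP) ∞ (fun z : P × H => op z.2 • z.1))
    {α : LieForm EP P E H} (hα : α.IsTypeAd) {c : ℝ}
    (hc : ∀ (X : GroupLieAlgebra 𝓘(ℝ, E) H) (p : P), α.form p (fundamentalVector X p) = c • X)
    {u : N → P} {a : N → H} {t : N → P} {n : N} (ha : MDifferentiableAt 𝓘(ℝ, EN) 𝓘(ℝ, E) a n)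
    (ht : MDifferentiableAt 𝓘(ℝ, EN) 𝓘(ℝ, EP) t n) (hu : u =ᶠ[𝓝 n] fun y => op (a y) • t y)
    (v : TangentSpace 𝓘(ℝ, EN) n) :
    α.form (u n) (mfderiv 𝓘(ℝ, EN) 𝓘(ℝ, EP) u n v) =
      Ad (E := E) (a n)⁻¹ (α.form (t n) (mfderiv 𝓘(ℝ, EN) 𝓘(ℝ, EP) t n v)) +
        c • maurerCartan (a n) (mfderiv 𝓘(ℝ, EN) 𝓘(ℝ, E) a n v) := by
  -- The base points `u n` and `t n · a n` are only propositionally equal, so the comparison takes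
  -- place in the total space of the tangent bundle.
  have h1 : (tangentMap 𝓘(ℝ, EN) 𝓘(ℝ, EP) u ⟨n, v⟩) =
      tangentMap 𝓘(ℝ, EN) 𝓘(ℝ, EP) (fun y => op (a y) • t y) ⟨n, v⟩ := by
    unfold tangentMap
    simp only [hu.mfderiv_eq]
    rw [hu.self_of_nhds]
  have h2 := congrArg (fun w : TangentBundle 𝓘(ℝ, EP) P => α.form w.1 w.2) h1
  refine h2.trans ?_
  refine (congrArg (α.form (op (a n) • t n)) (mfderiv_smul_apply hP ha ht v)).trans ?_
  rw [map_add, hα, hc]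

variable (E H) in
/-- The Maurer-Cartan form, as a connection on the trivial bundle `H` over a point. -/
def maurerCartanConnection : Connection E H E H where
  form := maurerCartan
  smooth := contMDiff_maurerCartan
  isTypeAd a b v := by
    have h : (fun x : H => (b * a)⁻¹ * (op a • x)) = fun x => a⁻¹ * (b⁻¹ * x) * a⁻¹⁻¹ := by
      ext x; simp [mul_assoc]
    have h1 := mfderiv_comp_apply_eq (g := fun x : H => (b * a)⁻¹ * x) (y := b * a)
      ((contMDiff_mul_left (I := 𝓘(ℝ, E)) (n := ∞)).mdifferentiable (by simp) _)
      ((contMDiff_mul_right (I := 𝓘(ℝ, E)) (n := ∞) (a := a)).mdifferentiable (by simp) b) rfl v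
    have h2 := mfderiv_comp_apply_eq (g := fun x : H => a⁻¹ * x * a⁻¹⁻¹) (y := 1)
      ((contMDiff_conj (E := E) a⁻¹).mdifferentiable (by simp) _)
      ((contMDiff_mul_left (I := 𝓘(ℝ, E)) (n := ∞) (a := b⁻¹)).mdifferentiable (by simp) b)
      (by simp) v
    rw [← h] at h2
    exact h1.symm.trans h2
  apply_fundamentalVector X b := by
    have h1 := mfderiv_comp_apply_eq (g := fun x : H => b⁻¹ * x) (f := fun x : H => b * x) (y := b)
      ((contMDiff_mul_left (I := 𝓘(ℝ, E)) (n := ∞)).mdifferentiable (by simp) _)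
      ((contMDiff_mul_left (I := 𝓘(ℝ, E)) (n := ∞) (a := b)).mdifferentiable (by simp) 1)
      (by simp) X
    have h : (fun x : H => b⁻¹ * (b * x)) = id := by ext x; simp
    rw [h, mfderiv_id] at h1
    exact h1.symm

/-- The Maurer-Cartan form of a product `y ↦ b(y) a(y)`. -/
theorem maurerCartan_mfderiv_mul {u a b : N → H} {n : N}
    (ha : MDifferentiableAt 𝓘(ℝ, EN) 𝓘(ℝ, E) a n) (hb : MDifferentiableAt 𝓘(ℝ, EN) 𝓘(ℝ, E) b n)
    (hu : u =ᶠ[𝓝 n] fun y => b y * a y) (v : TangentSpace 𝓘(ℝ, EN) n) :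
    maurerCartan (u n) (mfderiv 𝓘(ℝ, EN) 𝓘(ℝ, E) u n v) =
      Ad (E := E) (a n)⁻¹ (maurerCartan (b n) (mfderiv 𝓘(ℝ, EN) 𝓘(ℝ, E) b n v)) +
        maurerCartan (a n) (mfderiv 𝓘(ℝ, EN) 𝓘(ℝ, E) a n v) := by
  -- The product `b a` is the right action of `a` on `b`, so this is the product rule for the
  -- Maurer-Cartan connection.
  have := LieForm.form_mfderiv_smul (α := (maurerCartanConnection E H).toLieForm) (c := 1)
    (contMDiff_fst.mul contMDiff_snd) (maurerCartanConnection E H).isTypeAd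
    (fun X p => ((maurerCartanConnection E H).apply_fundamentalVector X p).trans (one_smul _ _).symm)
    ha hb hu v
  rw [one_smul] at this
  exact this

variable {EG : Type*} [NormedAddCommGroup EG] [NormedSpace ℝ EG]
  {G : Type*} [TopologicalSpace G] [ChartedSpace EG G] [Group G] [LieGroup 𝓘(ℝ, EG) ∞ G]
  {ι : G →* H}

/-- Differentiate at `1` the fact that `ι` intertwines conjugation by `g` with conjugation by `ι g`.
-/
theorem lieMap_Ad (hι : ContMDiff 𝓘(ℝ, EG) 𝓘(ℝ, E) ∞ ι) (g : G)
    (X : GroupLieAlgebra 𝓘(ℝ, EG) G) :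
    lieMap (E := E) ι (Ad (E := EG) g X) = Ad (E := E) (ι g) (lieMap (E := E) ι X) := by
  have h1 := mfderiv_comp_apply_eq (g := ι) (y := 1) (hι.mdifferentiable (by simp) _)
    ((contMDiff_conj (E := EG) g).mdifferentiable (by simp) 1) (by simp) X
  have h2 := mfderiv_comp_apply_eq (g := fun x => ι g * x * (ι g)⁻¹) (y := 1)
    ((contMDiff_conj (E := E) (ι g)).mdifferentiable (by simp) _)
    (hι.mdifferentiable (by simp) 1) (by simp) X
  have h : (fun x => ι (g * x * g⁻¹)) = fun x => ι g * ι x * (ι g)⁻¹ := by ext x; simp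
  rw [h] at h1
  exact h1.symm.trans h2

theorem maurerCartan_comp_hom (hι : ContMDiff 𝓘(ℝ, EG) 𝓘(ℝ, E) ∞ ι) {u : N → G} {n : N}
    (hu : MDifferentiableAt 𝓘(ℝ, EN) 𝓘(ℝ, EG) u n) (v : TangentSpace 𝓘(ℝ, EN) n) :
    maurerCartan (ι (u n)) (mfderiv 𝓘(ℝ, EN) 𝓘(ℝ, E) (fun y => ι (u y)) n v) =
      lieMap (E := E) ι (maurerCartan (u n) (mfderiv 𝓘(ℝ, EN) 𝓘(ℝ, EG) u n v)) := by
  have h1 := mfderiv_comp_apply_eq (g := ι) (y := u n) (hι.mdifferentiable (by simp) _) hu rfl v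
  have h2 := mfderiv_comp_apply_eq (g := fun x : H => (ι (u n))⁻¹ * x) (y := ι (u n))
    ((contMDiff_mul_left (I := 𝓘(ℝ, E)) (n := ∞)).mdifferentiable (by simp) _)
    (hι.mdifferentiable (by simp) (u n)) rfl (mfderiv 𝓘(ℝ, EN) 𝓘(ℝ, EG) u n v)
  have h3 := mfderiv_comp_apply_eq (g := ι) (y := 1) (hι.mdifferentiable (by simp) _)
    ((contMDiff_mul_left (I := 𝓘(ℝ, EG)) (n := ∞) (a := (u n)⁻¹)).mdifferentiable (by simp) (u n))
    (by simp) (mfderiv 𝓘(ℝ, EN) 𝓘(ℝ, EG) u n v)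
  have h : (fun x => ι ((u n)⁻¹ * x)) = fun x => (ι (u n))⁻¹ * ι x := by ext x; simp
  rw [h] at h3
  exact (congrArg (maurerCartan (E := E) (ι (u n))) h1).trans (h2.symm.trans h3)

end LieGroups

/-- The element `a` of the structure group with `p · a = q`, for `p` and `q` in the same fibre. -/
def transition {P H : Type*} [Group H] [MulAction Hᵐᵒᵖ P] (p q : P) : H :=
  Classical.epsilon fun a : H => op a • p = q

/-! ### Fibre transitions and local sections of principal bundles -/

section PrincipalBundle

variable {EP : Type*} [NormedAddCommGroup EP] [NormedSpace ℝ EP]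
  {P : Type*} [TopologicalSpace P] [ChartedSpace EP P]
  {EH : Type*} [NormedAddCommGroup EH] [NormedSpace ℝ EH]
  {H : Type*} [TopologicalSpace H] [ChartedSpace EH H] [Group H] [MulAction Hᵐᵒᵖ P]
  {EM : Type*} [NormedAddCommGroup EM] [NormedSpace ℝ EM]
  {M : Type*} [TopologicalSpace M] [ChartedSpace EM M]
  {π : P → M}

namespace IsPrincipalBundle

theorem smul_left_injective (hπ : IsPrincipalBundle EP EH H EM π) {a b : H} {p : P}
    (h : op a • p = op b • p) : a = b := by
  obtain ⟨e, hx, -, -, he⟩ := hπ.locallyTrivial (π p)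
  have hp : p ∈ e.source := e.mem_source.2 hx
  have h1 := he p hp a
  rw [h, he p hp b] at h1
  exact (mul_left_cancel (Prod.ext_iff.1 h1).2).symm

theorem exists_smul (hπ : IsPrincipalBundle EP EH H EM π) {p q : P} (h : π p = π q) :
    ∃ a : H, op a • p = q := by
  obtain ⟨e, hx, -, -, he⟩ := hπ.locallyTrivial (π p)
  have hp : p ∈ e.source := e.mem_source.2 hx
  have hq : q ∈ e.source := e.mem_source.2 (h ▸ hx)
  refine ⟨(e p).2⁻¹ * (e q).2, e.injOn (e.mem_source.2 ?_) hq ?_⟩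
  · rwa [hπ.proj_smul]
  · change e _ = e _
    rw [he p hp, e.coe_fst hp, h, mul_inv_cancel_left, ← e.coe_fst hq]

theorem transition_smul (hπ : IsPrincipalBundle EP EH H EM π) {p q : P} (h : π p = π q) :
    op (transition p q : H) • p = q :=
  Classical.epsilon_spec (hπ.exists_smul h)

theorem transition_eq (hπ : IsPrincipalBundle EP EH H EM π) {p q : P} {a : H}
    (h : op a • p = q) : transition p q = a :=
  hπ.smul_left_injective (p := p)
    ((hπ.transition_smul (by rw [← h, hπ.proj_smul])).trans h.symm)

/-- The transition element is chosen pointwise, but in an equivariant trivialisation it is the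
quotient of the two group coordinates. -/
theorem contMDiffAt_transition [LieGroup 𝓘(ℝ, EH) ∞ H] (hπ : IsPrincipalBundle EP EH H EM π)
    {EN HN : Type*} [NormedAddCommGroup EN] [NormedSpace ℝ EN] [TopologicalSpace HN]
    {IN : ModelWithCorners ℝ EN HN} {N : Type*} [TopologicalSpace N] [ChartedSpace HN N]
    {u v : N → P} {n : N} (hu : ContMDiffAt IN 𝓘(ℝ, EP) ∞ u n)
    (hv : ContMDiffAt IN 𝓘(ℝ, EP) ∞ v n) (huv : ∀ᶠ y in 𝓝 n, π (u y) = π (v y)) :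
    ContMDiffAt IN 𝓘(ℝ, EH) ∞ (fun y => (transition (u y) (v y) : H)) n := by
  obtain ⟨e, hx, hes, -, he⟩ := hπ.locallyTrivial (π (u n))
  have hun : u n ∈ e.source := e.mem_source.2 hx
  have hvn : v n ∈ e.source := e.mem_source.2 (huv.self_of_nhds ▸ hx)
  have h1 : ∀ {w : N → P}, ContMDiffAt IN 𝓘(ℝ, EP) ∞ w n → w n ∈ e.source →
      ContMDiffAt IN 𝓘(ℝ, EH) ∞ (fun y => (e (w y)).2) n := fun {w} hw hwn =>
    contMDiffAt_snd.comp n ((hes.contMDiffAt (e.open_source.mem_nhds hwn)).comp n hw)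
  refine ((h1 hu hun).inv.mul (h1 hv hvn)).congr_of_eventuallyEq ?_
  filter_upwards [huv, hu.continuousAt (e.open_source.mem_nhds hun),
    hv.continuousAt (e.open_source.mem_nhds hvn)] with y hy huy hvy
  refine hπ.transition_eq (e.injOn (e.mem_source.2 ?_) hvy ?_)
  · rw [hπ.proj_smul]; exact e.mem_source.1 huy
  · change e (op ((e (u y)).2⁻¹ * (e (v y)).2) • u y) = e _
    rw [he _ huy, e.coe_fst huy, hy, mul_inv_cancel_left, ← e.coe_fst hvy]

theorem exists_isLocalSection (hπ : IsPrincipalBundle EP EH H EM π) (x : M) :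
    ∃ (U : Set M) (s : M → P), x ∈ U ∧ IsLocalSection EM EP π U s := by
  obtain ⟨e, hx, -, hes, -⟩ := hπ.locallyTrivial x
  have ht : ∀ y ∈ e.baseSet, (y, (1 : H)) ∈ e.target := fun y hy => e.mem_target.2 hy
  refine ⟨e.baseSet, fun y => e.toOpenPartialHomeomorph.symm (y, 1), hx, e.open_baseSet, ?_, ?_⟩
  · exact hes.comp (contMDiff_id.prodMk contMDiff_const).contMDiffOn ht
  · exact fun y hy => e.proj_symm_apply (ht y hy)

theorem mfderiv_proj_rightDeriv (hπ : IsPrincipalBundle EP EH H EM π) (a : H) (p : P)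
    (v : TangentSpace 𝓘(ℝ, EP) p) :
    mfderiv 𝓘(ℝ, EP) 𝓘(ℝ, EM) π (op a • p) (rightDeriv a p v) =
      mfderiv 𝓘(ℝ, EP) 𝓘(ℝ, EM) π p v := by
  have h := mfderiv_comp_apply_eq (g := π) (y := op a • p) (hπ.smooth_proj.mdifferentiable (by simp) _)
    ((contMDiff_smul_left hπ.smooth_action a).mdifferentiable (by simp) p) rfl v
  have h1 : (fun z => π (op a • z)) = π := funext (hπ.proj_smul a)
  rw [h1] at h
  exact h.symm

theorem mfderiv_proj_fundamentalVector [LieGroup 𝓘(ℝ, EH) ∞ H]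
    (hπ : IsPrincipalBundle EP EH H EM π) (X : GroupLieAlgebra 𝓘(ℝ, EH) H) (p : P) :
    mfderiv 𝓘(ℝ, EP) 𝓘(ℝ, EM) π p (fundamentalVector X p) = 0 := by
  have h := mfderiv_comp_apply_eq (g := π) (y := p) (hπ.smooth_proj.mdifferentiable (by simp) _)
    ((contMDiff_smul_right hπ.smooth_action p).mdifferentiable (by simp) 1) (by simp) X
  have h1 : (fun a : H => π (op a • p)) = fun _ => π p := funext fun a => hπ.proj_smul a p
  rw [h1, mfderiv_const] at h
  exact h.symm

end IsPrincipalBundle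

theorem IsLocalSection.mono {U V : Set M} {s : M → P} (hs : IsLocalSection EM EP π U s)
    (hV : IsOpen V) (hVU : V ⊆ U) : IsLocalSection EM EP π V s :=
  ⟨hV, hs.smooth.mono hVU, fun x hx => hs.proj x (hVU hx)⟩

theorem IsLocalSection.contMDiffAt {U : Set M} {s : M → P} (hs : IsLocalSection EM EP π U s)
    {x : M} (hx : x ∈ U) : ContMDiffAt 𝓘(ℝ, EM) 𝓘(ℝ, EP) ∞ s x :=
  hs.smooth.contMDiffAt (hs.isOpen.mem_nhds hx)

theorem IsLocalSection.mdifferentiableAt {U : Set M} {s : M → P} (hs : IsLocalSection EM EP π U s)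
    {x : M} (hx : x ∈ U) : MDifferentiableAt 𝓘(ℝ, EM) 𝓘(ℝ, EP) s x :=
  (hs.contMDiffAt hx).mdifferentiableAt (by simp)

/-! ### The local formula for forms of type `Ad` -/

variable (π) in
/-- The vertical coordinate of the trivialisation of `P` determined by a local section `t`. -/
def fibreCoord (t : M → P) (p : P) : H := transition (t (π p)) p

theorem IsLocalSection.fibreCoord_smul (hπ : IsPrincipalBundle EP EH H EM π)
    {U : Set M} {t : M → P}
    (ht : IsLocalSection EM EP π U t) {p : P} (hp : π p ∈ U) :
    op (fibreCoord π t p : H) • t (π p) = p :=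
  hπ.transition_smul (ht.proj _ hp)

theorem eventually_proj_mem (hπ : IsPrincipalBundle EP EH H EM π)
    {U : Set M} (hU : IsOpen U) {p : P} (hp : π p ∈ U) : ∀ᶠ y in 𝓝 p, π y ∈ U :=
  hπ.smooth_proj.continuous.continuousAt (hU.mem_nhds hp)

variable (EP EM) in
/-- The form on `P` which restricts to `θ` along `t` and multiplies generators by `c`. -/
def localForm (π : P → M) (t : M → P)
    (θ : ∀ x : M, TangentSpace 𝓘(ℝ, EM) x →L[ℝ] GroupLieAlgebra 𝓘(ℝ, EH) H) (c : ℝ) (p : P) :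
    TangentSpace 𝓘(ℝ, EP) p →L[ℝ] GroupLieAlgebra 𝓘(ℝ, EH) H :=
  (Ad (E := EH) (fibreCoord π t p : H)⁻¹).comp
      ((θ (π p)).comp (mfderiv 𝓘(ℝ, EP) 𝓘(ℝ, EM) π p)) +
    c • (maurerCartan (fibreCoord π t p : H)).comp (mfderiv 𝓘(ℝ, EP) 𝓘(ℝ, EH) (fibreCoord π t) p)

theorem localForm_apply (t : M → P)
    (θ : ∀ x : M, TangentSpace 𝓘(ℝ, EM) x →L[ℝ] GroupLieAlgebra 𝓘(ℝ, EH) H) (c : ℝ) (p : P)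
    (v : TangentSpace 𝓘(ℝ, EP) p) :
    localForm EP EM π t θ c p v = Ad (E := EH) (fibreCoord π t p : H)⁻¹
        (θ (π p) (mfderiv 𝓘(ℝ, EP) 𝓘(ℝ, EM) π p v)) +
      c • maurerCartan (fibreCoord π t p : H) (mfderiv 𝓘(ℝ, EP) 𝓘(ℝ, EH) (fibreCoord π t) p v) :=
  rfl

variable [LieGroup 𝓘(ℝ, EH) ∞ H] {U : Set M} {t t' : M → P}
  {θ θ' : ∀ x : M, TangentSpace 𝓘(ℝ, EM) x →L[ℝ] GroupLieAlgebra 𝓘(ℝ, EH) H} {c : ℝ}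

theorem IsLocalSection.contMDiffAt_fibreCoord (hπ : IsPrincipalBundle EP EH H EM π)
    (ht : IsLocalSection EM EP π U t) {p : P} (hp : π p ∈ U) :
    ContMDiffAt 𝓘(ℝ, EP) 𝓘(ℝ, EH) ∞ (fibreCoord π t : P → H) p := by
  refine hπ.contMDiffAt_transition ((ht.contMDiffAt hp).comp p (hπ.smooth_proj p)) contMDiffAt_id ?_
  filter_upwards [hπ.smooth_proj.continuous.continuousAt (ht.isOpen.mem_nhds hp)] with y hy
  exact ht.proj _ hy

/-- The fibre coordinate satisfies `τ(p · a) = τ(p) a`; the constant factor `a` contributes no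
logarithmic derivative and acts by `Ad(a⁻¹)`, while `dπ` is unchanged. -/
theorem localForm_smul_rightDeriv (hπ : IsPrincipalBundle EP EH H EM π)
    (ht : IsLocalSection EM EP π U t) (a : H) {p : P} (hp : π p ∈ U) (v : TangentSpace 𝓘(ℝ, EP) p) :
    localForm EP EM π t θ c (op a • p) (rightDeriv a p v) =
      Ad (E := EH) a⁻¹ (localForm EP EM π t θ c p v) := by
  have hap : π (op a • p) ∈ U := by rwa [hπ.proj_smul]
  have hτ : ∀ y, π y ∈ U → fibreCoord π t (op a • y) = (fibreCoord π t y : H) * a := fun y hy =>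
    hπ.transition_eq (by
      rw [hπ.proj_smul, op_mul, mul_smul, ht.fibreCoord_smul hπ hy])
  have hd : ∀ y, π y ∈ U → MDifferentiableAt 𝓘(ℝ, EP) 𝓘(ℝ, EH) (fibreCoord π t : P → H) y :=
    fun y hy => (ht.contMDiffAt_fibreCoord hπ hy).mdifferentiableAt (by simp)
  have h1 := mfderiv_comp_apply_eq (g := (fibreCoord π t : P → H)) (y := op a • p)
    (hd _ hap) ((contMDiff_smul_left hπ.smooth_action a).mdifferentiable (by simp) p) rfl v
  have h2 := maurerCartan_mfderiv_mul (u := fun y => (fibreCoord π t (op a • y) : H))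
    (a := fun _ => a) mdifferentiableAt_const (hd p hp)
    ((eventually_proj_mem hπ ht.isOpen hp).mono hτ) v
  have h3 : maurerCartan (E := EH) a (mfderiv 𝓘(ℝ, EP) 𝓘(ℝ, EH) (fun _ : P => a) p v) = 0 := by
    rw [mfderiv_const]; exact map_zero _
  rw [h1, h3, add_zero] at h2
  -- Transports `θ` between equal base points, using that all tangent spaces are copies of the model
  -- space.
  have h4 : ∀ x y, x = y → ∀ w : EM, (θ x w : EH) = θ y w := by rintro x _ rfl w; rfl
  have h5 : θ (π (op a • p)) (mfderiv 𝓘(ℝ, EP) 𝓘(ℝ, EM) π (op a • p) (rightDeriv a p v)) =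
      θ (π p) (mfderiv 𝓘(ℝ, EP) 𝓘(ℝ, EM) π p v) :=
    (h4 _ _ (hπ.proj_smul a p) _).trans (congrArg (θ (π p)) (hπ.mfderiv_proj_rightDeriv a p v))
  rw [localForm_apply, localForm_apply, map_add, map_smul, ← Ad_mul, ← mul_inv_rev, ← hτ p hp]
  exact congrArg₂ (fun X Y : EH => X + c • Y) (congrArg _ h5) h2

/-- Vertical vectors kill the `θ` term, and along the orbit of `p` the fibre coordinate is left
translation by `τ(p)`, whose logarithmic derivative is `X`. -/
theorem localForm_fundamentalVector (hπ : IsPrincipalBundle EP EH H EM π)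
    (ht : IsLocalSection EM EP π U t) {p : P} (hp : π p ∈ U) (X : GroupLieAlgebra 𝓘(ℝ, EH) H) :
    localForm EP EM π t θ c p (fundamentalVector X p) = c • X := by
  have hτ : ∀ a : H, fibreCoord π t (op a • p) = (fibreCoord π t p : H) * a := fun a =>
    hπ.transition_eq (by
      rw [hπ.proj_smul, op_mul, mul_smul, ht.fibreCoord_smul hπ hp])
  have hd : MDifferentiableAt 𝓘(ℝ, EP) 𝓘(ℝ, EH) (fibreCoord π t : P → H) p :=
    (ht.contMDiffAt_fibreCoord hπ hp).mdifferentiableAt (by simp)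
  have h1 := mfderiv_comp_apply_eq (g := (fibreCoord π t : P → H)) (y := p)
    hd ((contMDiff_smul_right hπ.smooth_action p).mdifferentiable (by simp) (1 : H)) (by simp) X
  have h2 := (mfderiv_comp_apply_eq (g := fun x => (fibreCoord π t p : H)⁻¹ * x)
    (y := fibreCoord π t p)
    ((contMDiff_mul_left (I := 𝓘(ℝ, EH)) (n := ∞)).mdifferentiable (by simp) _)
    ((contMDiff_mul_left (I := 𝓘(ℝ, EH)) (n := ∞) (a := (fibreCoord π t p : H))).mdifferentiable
      (by simp) 1) (by simp) X)
  have h3 : (fun b : H => (fibreCoord π t p : H)⁻¹ * (fibreCoord π t p * b)) = id := by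
    ext x; simp
  rw [h3, mfderiv_id] at h2
  rw [funext hτ] at h1
  have h4 : maurerCartan (fibreCoord π t p : H)
      (mfderiv 𝓘(ℝ, EP) 𝓘(ℝ, EH) (fibreCoord π t) p (fundamentalVector X p)) = X :=
    (congrArg (maurerCartan (E := EH) (fibreCoord π t p : H)) h1.symm).trans h2.symm
  rw [localForm_apply, h4, hπ.mfderiv_proj_fundamentalVector, map_zero, map_zero, zero_add]

/-- Along `t` the fibre coordinate is constantly `1` and `π ∘ t` is the identity. -/
theorem localForm_apply_section (hπ : IsPrincipalBundle EP EH H EM π)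
    (ht : IsLocalSection EM EP π U t) {x : M} (hx : x ∈ U) (v : TangentSpace 𝓘(ℝ, EM) x) :
    localForm EP EM π t θ c (t x) (mfderiv 𝓘(ℝ, EM) 𝓘(ℝ, EP) t x v) = θ x v := by
  have hp : π (t x) ∈ U := by rwa [ht.proj x hx]
  have hτ : ∀ y ∈ U, fibreCoord π t (t y) = (1 : H) := fun y hy =>
    hπ.transition_eq (by rw [ht.proj y hy, op_one, one_smul])
  have h1 := mfderiv_comp_apply_eq (g := (fibreCoord π t : P → H)) (y := t x)
    ((ht.contMDiffAt_fibreCoord hπ hp).mdifferentiableAt (by simp)) (ht.mdifferentiableAt hx) rfl v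
  have e1 : (fun y => (fibreCoord π t (t y) : H)) =ᶠ[𝓝 x] fun _ => 1 :=
    Filter.eventually_of_mem (ht.isOpen.mem_nhds hx) hτ
  have h2 := mfderiv_comp_apply_eq (g := π) (y := t x)
    (hπ.smooth_proj.mdifferentiable (by simp) _) (ht.mdifferentiableAt hx) rfl v
  have e2 : (fun y => π (t y)) =ᶠ[𝓝 x] id := Filter.eventually_of_mem (ht.isOpen.mem_nhds hx) ht.proj
  rw [e1.mfderiv_eq, mfderiv_const] at h1
  rw [e2.mfderiv_eq, mfderiv_id] at h2
  have h4 : ∀ x y, x = y → ∀ w : EM, (θ x w : EH) = θ y w := by rintro x _ rfl w; rfl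
  have h5 : θ (π (t x)) (mfderiv 𝓘(ℝ, EP) 𝓘(ℝ, EM) π (t x) (mfderiv 𝓘(ℝ, EM) 𝓘(ℝ, EP) t x v)) =
      θ x v := (congrArg (θ (π (t x))) h2.symm).trans (h4 _ _ (ht.proj x hx) _)
  have h6 : maurerCartan (fibreCoord π t (t x) : H) (mfderiv 𝓘(ℝ, EP) 𝓘(ℝ, EH) (fibreCoord π t) (t x)
      (mfderiv 𝓘(ℝ, EM) 𝓘(ℝ, EP) t x v)) = 0 :=
    (congrArg (maurerCartan (E := EH) _) h1.symm).trans (map_zero _)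
  rw [localForm_apply, h5, h6, hτ x hx, inv_one, Ad_one, smul_zero, add_zero]

/-- The gluing step: the fibre coordinates are related by `τ = (k ∘ π) τ'`, and the product rule
turns this into the gauge transformation law assumed in `hθ`. -/
theorem localForm_eq_of_smul (hπ : IsPrincipalBundle EP EH H EM π)
    (ht : IsLocalSection EM EP π U t) (ht' : IsLocalSection EM EP π U t') {k : M → H} {p : P}
    (hp : π p ∈ U) (hk : MDifferentiableAt 𝓘(ℝ, EM) 𝓘(ℝ, EH) k (π p))
    (htk : ∀ x ∈ U, t' x = op (k x) • t x)
    (hθ : ∀ v : TangentSpace 𝓘(ℝ, EM) (π p), θ' (π p) v = Ad (E := EH) (k (π p))⁻¹ (θ (π p) v) +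
      c • maurerCartan (k (π p)) (mfderiv 𝓘(ℝ, EM) 𝓘(ℝ, EH) k (π p) v)) :
    localForm EP EM π t θ c p = localForm EP EM π t' θ' c p := by
  have hτ : ∀ y, π y ∈ U → fibreCoord π t y = k (π y) * (fibreCoord π t' y : H) := fun y hy =>
    hπ.transition_eq (by
      rw [op_mul, mul_smul, ← htk _ hy, ht'.fibreCoord_smul hπ hy])
  have hd' : MDifferentiableAt 𝓘(ℝ, EP) 𝓘(ℝ, EH) (fibreCoord π t' : P → H) p :=
    (ht'.contMDiffAt_fibreCoord hπ hp).mdifferentiableAt (by simp)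
  have hπd : MDifferentiableAt 𝓘(ℝ, EP) 𝓘(ℝ, EM) π p := hπ.smooth_proj.mdifferentiable (by simp) _
  ext v
  have h1 := maurerCartan_mfderiv_mul (b := fun y => k (π y)) hd' (hk.comp p hπd)
    ((eventually_proj_mem hπ ht.isOpen hp).mono hτ) v
  rw [mfderiv_comp_apply_eq (g := k) hk hπd rfl v] at h1
  rw [localForm_apply, localForm_apply, h1, hθ, hτ p hp, mul_inv_rev, Ad_mul, map_add, map_smul,
    smul_add, add_assoc]

theorem contMDiffOn_tangentMap {EK : Type*} [NormedAddCommGroup EK] [NormedSpace ℝ EK]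
    {K : Type*} [TopologicalSpace K] [ChartedSpace EK K] [IsManifold 𝓘(ℝ, EK) ∞ K]
    [IsManifold 𝓘(ℝ, EP) ∞ P] {f : P → K} {V : Set P} (hV : IsOpen V)
    (hf : ContMDiffOn 𝓘(ℝ, EP) 𝓘(ℝ, EK) ∞ f V) :
    ContMDiffOn 𝓘(ℝ, EP).tangent 𝓘(ℝ, EK).tangent ∞ (tangentMap 𝓘(ℝ, EP) 𝓘(ℝ, EK) f)
      (Bundle.TotalSpace.proj ⁻¹' V) := by
  have _ : IsManifold 𝓘(ℝ, EP) 1 P := .of_le (n := ∞) (by simp)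
  have _ : IsManifold 𝓘(ℝ, EK) 1 K := .of_le (n := ∞) (by simp)
  refine (hf.contMDiffOn_tangentMapWithin (m := ∞) (by simp) hV.uniqueMDiffOn).congr fun v hv => ?_
  unfold tangentMap tangentMapWithin
  rw [mfderivWithin_of_isOpen hV hv]

theorem contMDiffOn_localForm [IsManifold 𝓘(ℝ, EP) ∞ P] [IsManifold 𝓘(ℝ, EM) ∞ M]
    (hπ : IsPrincipalBundle EP EH H EM π) (ht : IsLocalSection EM EP π U t)
    (hθ : ContMDiffOn 𝓘(ℝ, EM).tangent 𝓘(ℝ, EH) (M' := EH) ∞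
      (fun v : TangentBundle 𝓘(ℝ, EM) M => (θ v.1 v.2 : EH)) (Bundle.TotalSpace.proj ⁻¹' U)) :
    ContMDiffOn 𝓘(ℝ, EP).tangent 𝓘(ℝ, EH) (M' := EH) ∞
      (fun v : TangentBundle 𝓘(ℝ, EP) P => (localForm EP EM π t θ c v.1 v.2 : EH))
      (Bundle.TotalSpace.proj ⁻¹' (π ⁻¹' U)) := by
  have _ : IsManifold 𝓘(ℝ, EP) 1 P := .of_le (n := ∞) (by simp)
  have hV : IsOpen (π ⁻¹' U) := ht.isOpen.preimage hπ.smooth_proj.continuous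
  have hτ : ContMDiffOn 𝓘(ℝ, EP) 𝓘(ℝ, EH) ∞ (fibreCoord π t : P → H) (π ⁻¹' U) :=
    fun p hp => (ht.contMDiffAt_fibreCoord hπ hp).contMDiffWithinAt
  have h1 : ContMDiffOn 𝓘(ℝ, EP).tangent 𝓘(ℝ, EH) ∞
      (fun v : TangentBundle 𝓘(ℝ, EP) P => (fibreCoord π t v.1 : H)⁻¹)
      (Bundle.TotalSpace.proj ⁻¹' (π ⁻¹' U)) :=
    (hτ.comp (Bundle.contMDiff_proj (TangentSpace 𝓘(ℝ, EP) (M := P))).contMDiffOn (fun v hv => hv)).inv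
  have h2 := hθ.comp (contMDiffOn_tangentMap (V := π ⁻¹' U) hV hπ.smooth_proj.contMDiffOn)
    (fun v hv => hv)
  have h3 := contMDiff_Ad.comp_contMDiffOn (h1.prodMk h2)
  have h4 := (contMDiff_maurerCartan (E := EH) (H := H)).comp_contMDiffOn
    (contMDiffOn_tangentMap hV hτ)
  exact h3.add ((contDiff_const_smul c).contMDiff.comp_contMDiffOn h4)

end PrincipalBundle

/-! ### Reductions, and forms determined by their local sections -/

section Reduction

variable (EP : Type*) [NormedAddCommGroup EP] [NormedSpace ℝ EP]
  {P : Type*} [TopologicalSpace P] [ChartedSpace EP P]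
  {H : Type*} [Group H] [MulAction Hᵐᵒᵖ P]
  (EM : Type*) [NormedAddCommGroup EM] [NormedSpace ℝ EM]
  {M : Type*} [TopologicalSpace M] [ChartedSpace EM M]
  (EQ : Type*) [NormedAddCommGroup EQ] [NormedSpace ℝ EQ]
  {Q : Type*} [TopologicalSpace Q] [ChartedSpace EQ Q]
  {G : Type*} [Group G] [MulAction Gᵐᵒᵖ Q]

/-- An invariant submanifold `j : Q → P` which has local sections and whose fibres are
`G`-orbits. -/
structure IsReduction (π : P → M) (ι : G →* H) (j : Q → P) : Prop
    extends IsInvariantSubmanifold EP EQ ι j where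
  exists_isLocalSection : ∀ x : M, ∃ (U : Set M) (s : M → Q),
    x ∈ U ∧ IsLocalSection EM EQ (fun q => π (j q)) U s
  exists_smul : ∀ q q' : Q, π (j q) = π (j q') → ∃ g : G, op g • q = q'

variable {EP EM EQ} {π : P → M} {ι : G →* H} {j : Q → P}

theorem IsInvariantSubmanifold.isLocalSection_comp (hj : IsInvariantSubmanifold EP EQ ι j)
    {U : Set M} {s : M → Q} (hs : IsLocalSection EM EQ (fun q => π (j q)) U s) :
    IsLocalSection EM EP π U (fun x => j (s x)) :=
  ⟨hs.isOpen, hj.embedding.contMDiff.comp_contMDiffOn hs.smooth, hs.proj⟩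

variable {EG : Type*} [NormedAddCommGroup EG] [NormedSpace ℝ EG]
  [TopologicalSpace G] [ChartedSpace EG G]

theorem IsPrincipalSubbundle.isReduction (hj : IsPrincipalSubbundle EP EM EQ EG π ι j) :
    IsReduction EP EM EQ π ι j :=
  { hj.toIsInvariantSubmanifold with
    exists_isLocalSection := hj.isPrincipalBundle.exists_isLocalSection
    exists_smul := fun _ _ h => hj.isPrincipalBundle.exists_smul h }

variable {EH : Type*} [NormedAddCommGroup EH] [NormedSpace ℝ EH]
  [TopologicalSpace H] [ChartedSpace EH H] [LieGroup 𝓘(ℝ, EG) ∞ G]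

section

variable [IsManifold 𝓘(ℝ, EP) ∞ P] [IsManifold 𝓘(ℝ, EQ) ∞ Q]

/-- The action of the subgroup on an invariant submanifold is smooth. -/
theorem IsInvariantSubmanifold.contMDiff_smul
    (hP : ContMDiff (𝓘(ℝ, EP).prod 𝓘(ℝ, EH)) 𝓘(ℝ, EP) ∞ (fun z : P × H => op z.2 • z.1))
    (hι : ContMDiff 𝓘(ℝ, EG) 𝓘(ℝ, EH) ∞ ι) (hj : IsInvariantSubmanifold EP EQ ι j) :
    ContMDiff (𝓘(ℝ, EQ).prod 𝓘(ℝ, EG)) 𝓘(ℝ, EQ) ∞ (fun z : Q × G => op z.2 • z.1) := by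
  intro z
  refine contMDiffAt_of_comp_embedding hj.embedding ?_
  simp only [hj.map_smul]
  exact (hP.comp ((hj.embedding.contMDiff.comp contMDiff_fst).prodMk
    (hι.comp contMDiff_snd))).contMDiffAt

end

variable [LieGroup 𝓘(ℝ, EH) ∞ H]

/-- Two smooth maps into `Q` over the same map into `M` differ by a smooth map into `G`. -/
theorem IsReduction.exists_contMDiffOn_smul (hπ : IsPrincipalBundle EP EH H EM π)
    (hι : Manifold.IsSmoothEmbedding 𝓘(ℝ, EG) 𝓘(ℝ, EH) ∞ ι) (hj : IsReduction EP EM EQ π ι j)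
    {EN : Type*} [NormedAddCommGroup EN] [NormedSpace ℝ EN] {N : Type*} [TopologicalSpace N]
    [ChartedSpace EN N] [IsManifold 𝓘(ℝ, EN) ∞ N] {U : Set N} (hU : IsOpen U) {u v : N → Q}
    (hu : ContMDiffOn 𝓘(ℝ, EN) 𝓘(ℝ, EQ) ∞ u U) (hv : ContMDiffOn 𝓘(ℝ, EN) 𝓘(ℝ, EQ) ∞ v U)
    (huv : ∀ y ∈ U, π (j (u y)) = π (j (v y))) :
    ∃ g : N → G, ContMDiffOn 𝓘(ℝ, EN) 𝓘(ℝ, EG) ∞ g U ∧ ∀ y ∈ U, v y = op (g y) • u y := by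
  have hg : ∀ y ∈ U, op (transition (u y) (v y) : G) • u y = v y := fun y hy =>
    Classical.epsilon_spec (hj.exists_smul _ _ (huv y hy))
  refine ⟨fun y => transition (u y) (v y), fun y hy => ContMDiffAt.contMDiffWithinAt ?_,
    fun y hy => (hg y hy).symm⟩
  have hyU := hU.mem_nhds hy
  -- Smoothness of the `G`-valued transition is tested in `H`, where it agrees with the smooth
  -- transition of `P`.
  refine contMDiffAt_of_comp_embedding hι ?_
  have h1 := hπ.contMDiffAt_transition (hj.embedding.contMDiff.contMDiffAt.comp y
    (hu.contMDiffAt hyU)) (hj.embedding.contMDiff.contMDiffAt.comp y (hv.contMDiffAt hyU))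
    (Filter.eventually_of_mem hyU huv)
  refine h1.congr_of_eventuallyEq (Filter.eventually_of_mem hyU fun z hz => ?_)
  refine (hπ.transition_eq ?_).symm
  simp only [Function.comp_apply]
  rw [← hj.map_smul, hg z hz]

variable [IsManifold 𝓘(ℝ, EP) ∞ P]

/-- The value of a form of type `Ad` which multiplies generators by `c` is determined by its values
along a local section. -/
theorem LieForm.form_eq_localForm (hπ : IsPrincipalBundle EP EH H EM π) {α : LieForm EP P EH H}
    (hα : α.IsTypeAd) {c : ℝ}
    (hc : ∀ (X : GroupLieAlgebra 𝓘(ℝ, EH) H) (p : P), α.form p (fundamentalVector X p) = c • X)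
    {U : Set M} {t : M → P} (ht : IsLocalSection EM EP π U t) {p : P} (hp : π p ∈ U) :
    α.form p = localForm EP EM π t
      (fun x => (α.form (t x)).comp (mfderiv 𝓘(ℝ, EM) 𝓘(ℝ, EP) t x)) c p := by
  ext v
  have hπd : MDifferentiableAt 𝓘(ℝ, EP) 𝓘(ℝ, EM) π p := hπ.smooth_proj.mdifferentiable (by simp) _
  have h1 := LieForm.form_mfderiv_smul hπ.smooth_action hα hc (u := id) (t := fun y => t (π y))
    ((ht.contMDiffAt_fibreCoord hπ hp).mdifferentiableAt (by simp))
    ((ht.mdifferentiableAt hp).comp p hπd)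
    ((eventually_proj_mem hπ ht.isOpen hp).mono fun y hy => (ht.fibreCoord_smul hπ hy).symm) v
  rw [mfderiv_id, mfderiv_comp_apply_eq (g := t) (ht.mdifferentiableAt hp) hπd rfl] at h1
  exact h1

-- Every fibre of `π` meets a local section of `Q`, so `LieForm.form_eq_localForm` recovers both
-- forms from the same data.
omit [TopologicalSpace G] in
theorem IsReduction.lieForm_ext (hπ : IsPrincipalBundle EP EH H EM π)
    (hj : IsReduction EP EM EQ π ι j) {α β : LieForm EP P EH H} (hα : α.IsTypeAd)
    (hβ : β.IsTypeAd) {c : ℝ}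
    (hαc : ∀ (X : GroupLieAlgebra 𝓘(ℝ, EH) H) (p : P), α.form p (fundamentalVector X p) = c • X)
    (hβc : ∀ (X : GroupLieAlgebra 𝓘(ℝ, EH) H) (p : P), β.form p (fundamentalVector X p) = c • X)
    (h : ∀ (U : Set M) (s : M → Q), IsLocalSection EM EQ (fun q => π (j q)) U s → ∀ x ∈ U,
      ∀ v : TangentSpace 𝓘(ℝ, EM) x,
        α.form (j (s x)) (mfderiv 𝓘(ℝ, EM) 𝓘(ℝ, EP) (fun y => j (s y)) x v) =
          β.form (j (s x)) (mfderiv 𝓘(ℝ, EM) 𝓘(ℝ, EP) (fun y => j (s y)) x v)) :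
    α = β := by
  refine LieForm.ext (funext fun p => ?_)
  obtain ⟨U, s, hx, hs⟩ := hj.exists_isLocalSection (π p)
  have ht := hj.isLocalSection_comp hs
  rw [α.form_eq_localForm hπ hα hαc ht hx, β.form_eq_localForm hπ hβ hβc ht hx]
  ext v
  rw [localForm_apply, localForm_apply]
  congr 2
  exact h U s hs _ hx _

variable [IsManifold 𝓘(ℝ, EM) ∞ M]

/-- A compatible family of forms along the local sections of `Q` is induced by a form on `P`
of type `Ad`. -/
theorem IsReduction.exists_lieForm (hπ : IsPrincipalBundle EP EH H EM π)
    (hι : Manifold.IsSmoothEmbedding 𝓘(ℝ, EG) 𝓘(ℝ, EH) ∞ ι) (hj : IsReduction EP EM EQ π ι j)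
    (c : ℝ)
    (θ : (M → Q) → ∀ x : M, TangentSpace 𝓘(ℝ, EM) x →L[ℝ] GroupLieAlgebra 𝓘(ℝ, EH) H)
    (hθ : ∀ (U : Set M) (s : M → Q), IsLocalSection EM EQ (fun q => π (j q)) U s →
      ContMDiffOn 𝓘(ℝ, EM).tangent 𝓘(ℝ, EH) (M' := EH) ∞
        (fun v : TangentBundle 𝓘(ℝ, EM) M => (θ s v.1 v.2 : EH)) (Bundle.TotalSpace.proj ⁻¹' U))
    (hθg : ∀ (U : Set M) (s s' : M → Q) (g : M → G),
      IsLocalSection EM EQ (fun q => π (j q)) U s → IsLocalSection EM EQ (fun q => π (j q)) U s' →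
      ContMDiffOn 𝓘(ℝ, EM) 𝓘(ℝ, EG) ∞ g U → (∀ x ∈ U, s' x = op (g x) • s x) →
      ∀ x ∈ U, ∀ v : TangentSpace 𝓘(ℝ, EM) x, θ s' x v = Ad (E := EH) (ι (g x))⁻¹ (θ s x v) +
        c • maurerCartan (ι (g x)) (mfderiv 𝓘(ℝ, EM) 𝓘(ℝ, EH) (fun y => ι (g y)) x v)) :
    ∃ α : LieForm EP P EH H, α.IsTypeAd ∧
      (∀ (X : GroupLieAlgebra 𝓘(ℝ, EH) H) (p : P), α.form p (fundamentalVector X p) = c • X) ∧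
      ∀ (U : Set M) (s : M → Q), IsLocalSection EM EQ (fun q => π (j q)) U s → ∀ x ∈ U,
        ∀ v : TangentSpace 𝓘(ℝ, EM) x,
          α.form (j (s x)) (mfderiv 𝓘(ℝ, EM) 𝓘(ℝ, EP) (fun y => j (s y)) x v) = θ s x v := by
  choose U s hxU hs using hj.exists_isLocalSection
  -- The section is chosen separately over each base point; `hF` shows that the choice does not
  -- matter, which is what makes `F` smooth and equivariant.
  let F : ∀ p : P, TangentSpace 𝓘(ℝ, EP) p →L[ℝ] GroupLieAlgebra 𝓘(ℝ, EH) H := fun p =>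
    localForm EP EM π (fun x => j (s (π p) x)) (θ (s (π p))) c p
  have hF : ∀ (V : Set M) (r : M → Q), IsLocalSection EM EQ (fun q => π (j q)) V r →
      ∀ p, π p ∈ V → F p = localForm EP EM π (fun x => j (r x)) (θ r) c p := by
    intro V r hr p hp
    have hW : IsOpen (U (π p) ∩ V) := (hs (π p)).isOpen.inter hr.isOpen
    have h1 := (hs (π p)).mono hW Set.inter_subset_left
    have h2 := hr.mono hW Set.inter_subset_right
    obtain ⟨g, hg, hgs⟩ := hj.exists_contMDiffOn_smul hπ hι hW h1.smooth h2.smooth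
      fun y hy => (h1.proj y hy).trans (h2.proj y hy).symm
    have hpW : π p ∈ U (π p) ∩ V := ⟨hxU _, hp⟩
    refine localForm_eq_of_smul hπ (hj.isLocalSection_comp h1) (hj.isLocalSection_comp h2)
      (k := fun x => ι (g x)) hpW
      ((hι.contMDiff.contMDiffAt.comp _ (hg.contMDiffAt (hW.mem_nhds hpW))).mdifferentiableAt
        (by simp)) (fun x hx => ?_) (hθg _ _ _ g h1 h2 hg hgs _ hpW)
    rw [hgs x hx, hj.map_smul]
  refine ⟨⟨F, fun v => ?_⟩, fun a p v => ?_, fun X p => ?_, fun V r hr x hx v => ?_⟩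
  · have ht := hj.isLocalSection_comp (hs (π v.1))
    have hV : IsOpen (Bundle.TotalSpace.proj ⁻¹' (π ⁻¹' U (π v.1)) :
        Set (TangentBundle 𝓘(ℝ, EP) P)) := by
      have _ : IsManifold 𝓘(ℝ, EP) 1 P := .of_le (n := ∞) (by simp)
      exact ((hs (π v.1)).isOpen.preimage hπ.smooth_proj.continuous).preimage
        (FiberBundle.continuous_proj EP (TangentSpace 𝓘(ℝ, EP) (M := P)))
    have hvV : v ∈ (Bundle.TotalSpace.proj ⁻¹' (π ⁻¹' U (π v.1)) :
        Set (TangentBundle 𝓘(ℝ, EP) P)) := hxU (π v.1)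
    refine ((contMDiffOn_localForm (c := c) hπ ht (hθ _ _ (hs (π v.1)))).contMDiffAt
      (hV.mem_nhds hvV)).congr_of_eventuallyEq (Filter.eventually_of_mem (hV.mem_nhds hvV) ?_)
    intro w hw
    exact congrArg (fun T => T w.2) (hF _ _ (hs (π v.1)) w.1 hw)
  · have ht := hj.isLocalSection_comp (hs (π p))
    have h1 := hF _ _ (hs (π p)) (op a • p) (by rw [hπ.proj_smul]; exact hxU _)
    exact (congrArg (fun T => T (rightDeriv a p v)) h1).trans
      (localForm_smul_rightDeriv hπ ht a (hxU _) v)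
  · exact localForm_fundamentalVector hπ (hj.isLocalSection_comp (hs (π p))) (hxU _) X
  · change F (j (r x)) _ = _
    rw [hF V r hr (j (r x)) (by rwa [hr.proj x hx])]
    exact localForm_apply_section hπ (hj.isLocalSection_comp hr) hx v

end Reduction

/-! ### The Lie algebra of the subgroup and its normaliser -/

section Subgroup

variable {E : Type*} [NormedAddCommGroup E] [NormedSpace ℝ E]
  {H : Type*} [TopologicalSpace H] [ChartedSpace E H] [Group H] [LieGroup 𝓘(ℝ, E) ∞ H]
  {EG : Type*} [NormedAddCommGroup EG] [NormedSpace ℝ EG]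
  {G : Type*} [TopologicalSpace G] [ChartedSpace EG G] [Group G] [LieGroup 𝓘(ℝ, EG) ∞ G]
  {EN : Type*} [NormedAddCommGroup EN] [NormedSpace ℝ EN]
  {N : Type*} [TopologicalSpace N] [ChartedSpace EN N] [IsManifold 𝓘(ℝ, EN) ∞ N]
  {ι : G →* H}

/-- The logarithmic derivative of a map with values in a Lie subgroup takes values in its Lie
algebra. -/
theorem maurerCartan_mem_lieSubspace (hι : Manifold.IsSmoothEmbedding 𝓘(ℝ, EG) 𝓘(ℝ, E) ∞ ι)
    {k : N → H} {n : N} (hk : ContMDiffAt 𝓘(ℝ, EN) 𝓘(ℝ, E) ∞ k n) (hkG : ∀ y, k y ∈ ι.range)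
    (v : TangentSpace 𝓘(ℝ, EN) n) :
    maurerCartan (k n) (mfderiv 𝓘(ℝ, EN) 𝓘(ℝ, E) k n v) ∈ lieSubspace (E := E) (EG := EG) ι := by
  -- The lift `u` to `G` is chosen pointwise; it is smooth because `ι` is an embedding.
  choose u hu using hkG
  obtain rfl : (fun y => ι (u y)) = k := funext hu
  rw [maurerCartan_comp_hom hι.contMDiff
    ((contMDiffAt_of_comp_embedding hι hk).mdifferentiableAt (by simp))]
  exact ⟨_, rfl⟩

/-- The map `g ↦ a g a⁻¹` takes values in `G`, and its logarithmic derivative at `1` is `Ad a`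
restricted to `𝔤`. -/
theorem Ad_mem_lieSubspace (hι : Manifold.IsSmoothEmbedding 𝓘(ℝ, EG) 𝓘(ℝ, E) ∞ ι) {a : H}
    (ha : a ∈ Subgroup.normalizer (ι.range : Set H)) {X : GroupLieAlgebra 𝓘(ℝ, E) H}
    (hX : X ∈ lieSubspace (E := E) (EG := EG) ι) :
    Ad (E := E) a X ∈ lieSubspace (E := E) (EG := EG) ι := by
  obtain ⟨Y, rfl⟩ := hX
  have h1 := maurerCartan_mem_lieSubspace hι (k := fun g : G => a * ι g * a⁻¹) (n := 1)
    (((contMDiff_conj (E := E) a).comp hι.contMDiff).contMDiffAt)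
    (fun g => (Subgroup.mem_normalizer_iff.1 ha (ι g)).1 ⟨g, rfl⟩) Y
  have h2 := mfderiv_comp_apply_eq (g := fun x => a * x * a⁻¹) (y := 1)
    ((contMDiff_conj (E := E) a).mdifferentiable (by simp) _)
    (hι.contMDiff.mdifferentiable (by simp) 1) (by simp) Y
  have h3 : ∀ b : H, b = 1 → ∀ w : E, (maurerCartan (E := E) b w : E) = w := by
    rintro _ rfl w
    have h : (fun x : H => 1⁻¹ * x) = id := by ext x; simp
    unfold maurerCartan
    rw [h, mfderiv_id]
    rfl
  have h4 := (h3 (a * ι 1 * a⁻¹) (by simp) _).trans h2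
  rw [h4] at h1
  exact h1

/-- If `h` takes values in the normaliser of `G`, then `Ad (G)` fixes its logarithmic derivative
modulo `𝔤`. -/
theorem Ad_maurerCartan_sub_mem (hι : Manifold.IsSmoothEmbedding 𝓘(ℝ, EG) 𝓘(ℝ, E) ∞ ι)
    {h : N → H} (hh : ContMDiff 𝓘(ℝ, EN) 𝓘(ℝ, E) ∞ h)
    (hN : ∀ x, h x ∈ Subgroup.normalizer (ι.range : Set H)) (g : G) (x : N)
    (v : TangentSpace 𝓘(ℝ, EN) x) :
    Ad (E := E) (ι g)⁻¹ (maurerCartan (h x) (mfderiv 𝓘(ℝ, EN) 𝓘(ℝ, E) h x v)) -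
      maurerCartan (h x) (mfderiv 𝓘(ℝ, EN) 𝓘(ℝ, E) h x v) ∈
        lieSubspace (E := E) (EG := EG) ι := by
  have hk : ContMDiff 𝓘(ℝ, EN) 𝓘(ℝ, E) ∞ (fun y => h y * ι g * (h y)⁻¹) :=
    (hh.mul contMDiff_const).mul hh.inv
  have hd := hh.mdifferentiable (by simp) x
  have h1 := maurerCartan_mfderiv_mul (u := fun y => h y * ι g) hd
    (hk.mdifferentiable (by simp) x) (.of_forall fun y => by simp) v
  have h2 := maurerCartan_mfderiv_mul (u := fun y => h y * ι g) (a := fun _ => ι g)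
    mdifferentiableAt_const hd (.of_forall fun y => rfl) v
  have h3 : maurerCartan (E := E) (ι g) (mfderiv 𝓘(ℝ, EN) 𝓘(ℝ, E) (fun _ : N => ι g) x v) = 0 := by
    rw [mfderiv_const]; exact map_zero _
  -- `h1` and `h2` expand the same logarithmic derivative, of `(h g h⁻¹) h` and of `h g`; their
  -- comparison leaves only the term from `h g h⁻¹`.
  rw [h3, add_zero] at h2
  rw [← h2, h1, add_sub_cancel_right]
  exact Ad_mem_lieSubspace hι (inv_mem (hN x)) (maurerCartan_mem_lieSubspace hι hk.contMDiffAt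
    (fun y => (Subgroup.mem_normalizer_iff.1 (hN y) (ι g)).1 ⟨g, rfl⟩) v)

end Subgroup

theorem mem_normalizer_range {G H : Type*} [Group G] [Group H] (ι : G →* H) (g : G) :
    ι g ∈ Subgroup.normalizer (ι.range : Set H) :=
  Subgroup.le_normalizer ⟨g, rfl⟩

theorem projection_apply_of_invariant {V : Type*} [AddCommGroup V] [Module ℝ V]
    {p q : Submodule ℝ V} (hpq : IsCompl p q) {T : V →ₗ[ℝ] V} (hp : ∀ x ∈ p, T x ∈ p)
    (hq : ∀ x ∈ q, T x ∈ q) (x : V) : p.projection q hpq (T x) = T (p.projection q hpq x) := by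
  conv_lhs => rw [← Submodule.projection_add_projection_eq_self hpq x]
  rw [map_add, map_add,
    Submodule.projection_apply_of_mem_left hpq (hp _ (Submodule.projection_apply_mem hpq x)),
    (Submodule.projection_apply_eq_zero_iff hpq).2
      (hq _ (Submodule.projection_apply_mem hpq.symm x)), add_zero]

/-! ### Extension and projected restriction of connections -/

section Connections

variable {EP : Type*} [NormedAddCommGroup EP] [NormedSpace ℝ EP]
  {P : Type*} [TopologicalSpace P] [ChartedSpace EP P] [IsManifold 𝓘(ℝ, EP) ∞ P]
  {EH : Type*} [NormedAddCommGroup EH] [NormedSpace ℝ EH]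
  {H : Type*} [TopologicalSpace H] [ChartedSpace EH H] [Group H] [MulAction Hᵐᵒᵖ P]

theorem Connection.ext_form {A B : Connection EP P EH H}
    (h : ∀ (p : P) (v : TangentSpace 𝓘(ℝ, EP) p), A.form p v = B.form p v) : A = B := by
  obtain ⟨⟨a, _⟩, _, _⟩ := A
  obtain ⟨⟨b, _⟩, _, _⟩ := B
  obtain rfl : a = b := funext fun p => ContinuousLinearMap.ext (h p)
  rfl

theorem Connection.form_fundamentalVector (B : Connection EP P EH H)
    (X : GroupLieAlgebra 𝓘(ℝ, EH) H) (p : P) : B.form p (fundamentalVector X p) = (1 : ℝ) • X :=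
  (B.apply_fundamentalVector X p).trans (one_smul ℝ X).symm

/-- The sum of a connection and a form of type `Ad` which vanishes on fundamental vectors. -/
def Connection.add (B : Connection EP P EH H) (α : LieForm EP P EH H) (hα : α.IsTypeAd)
    (hα0 : ∀ (X : GroupLieAlgebra 𝓘(ℝ, EH) H) (p : P),
      α.form p (fundamentalVector X p) = (0 : ℝ) • X) : Connection EP P EH H where
  form p := B.form p + α.form p
  smooth := B.smooth.add α.smooth
  isTypeAd a p v := by
    rw [add_apply, add_apply, B.isTypeAd, hα, map_add]
  apply_fundamentalVector X p := by
    rw [add_apply, B.apply_fundamentalVector, hα0, zero_smul, add_zero]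

variable {EQ : Type*} [NormedAddCommGroup EQ] [NormedSpace ℝ EQ]
  {Q : Type*} [TopologicalSpace Q] [ChartedSpace EQ Q] [IsManifold 𝓘(ℝ, EQ) ∞ Q]
  {EG : Type*} [NormedAddCommGroup EG] [NormedSpace ℝ EG]
  {G : Type*} [TopologicalSpace G] [ChartedSpace EG G] [Group G] [LieGroup 𝓘(ℝ, EG) ∞ G]
  [MulAction Gᵐᵒᵖ Q] [LieGroup 𝓘(ℝ, EH) ∞ H]
  {EM : Type*} [NormedAddCommGroup EM] [NormedSpace ℝ EM]
  {M : Type*} [TopologicalSpace M] [ChartedSpace EM M]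
  {π : P → M} {ι : G →* H} {j : Q → P}

omit [IsManifold 𝓘(ℝ, EP) ∞ P] [IsManifold 𝓘(ℝ, EQ) ∞ Q] [TopologicalSpace H]
  [TopologicalSpace G] in
theorem IsInvariantSubmanifold.mfderiv_section (hj : IsInvariantSubmanifold EP EQ ι j) {U : Set M}
    {s : M → Q} (hs : IsLocalSection EM EQ (fun q => π (j q)) U s) {x : M} (hx : x ∈ U)
    (v : TangentSpace 𝓘(ℝ, EM) x) :
    mfderiv 𝓘(ℝ, EM) 𝓘(ℝ, EP) (fun y => j (s y)) x v =
      mfderiv 𝓘(ℝ, EQ) 𝓘(ℝ, EP) j (s x) (mfderiv 𝓘(ℝ, EM) 𝓘(ℝ, EQ) s x v) :=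
  mfderiv_comp_apply_eq (hj.embedding.contMDiff.mdifferentiable (by simp) _)
    (hs.mdifferentiableAt hx) rfl v

/-- A connection extends another one as soon as it does so along local sections. -/
theorem IsReduction.extends_of_section (hπ : IsPrincipalBundle EP EH H EM π)
    (hι : Manifold.IsSmoothEmbedding 𝓘(ℝ, EG) 𝓘(ℝ, EH) ∞ ι) (hj : IsReduction EP EM EQ π ι j)
    {A : Connection EQ Q EG G} {B : Connection EP P EH H}
    (h : ∀ (U : Set M) (s : M → Q), IsLocalSection EM EQ (fun q => π (j q)) U s → ∀ x ∈ U,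
      ∀ v : TangentSpace 𝓘(ℝ, EM) x,
        B.form (j (s x)) (mfderiv 𝓘(ℝ, EM) 𝓘(ℝ, EP) (fun y => j (s y)) x v) =
          lieMap (E := EH) ι (A.form (s x) (mfderiv 𝓘(ℝ, EM) 𝓘(ℝ, EQ) s x v))) :
    Extends ι j A B := by
  intro q ξ
  obtain ⟨U, s, hxU, hs⟩ := hj.exists_isLocalSection (π (j q))
  have hQ := hj.contMDiff_smul hπ.smooth_action hι.contMDiff
  have hπj : ContMDiff 𝓘(ℝ, EQ) 𝓘(ℝ, EM) ∞ (fun q => π (j q)) :=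
    hπ.smooth_proj.comp hj.embedding.contMDiff
  have hV : IsOpen ((fun q => π (j q)) ⁻¹' U) := hs.isOpen.preimage hπj.continuous
  have hqV := hV.mem_nhds (show q ∈ (fun q => π (j q)) ⁻¹' U from hxU)
  -- Near `q` every point of `Q` is `s(π y) · g(y)`. Expanding `A` and `B` by the product rule
  -- reduces the claim to `s`, since `lieMap ι` respects `Ad` and the Maurer-Cartan forms.
  obtain ⟨g, hg, hgs⟩ := hj.exists_contMDiffOn_smul hπ hι hV (v := id)
    (hs.smooth.comp hπj.contMDiffOn fun y hy => hy) contMDiffOn_id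
    fun y hy => hs.proj _ hy
  have hgd := (hg.contMDiffAt hqV).mdifferentiableAt (by simp)
  have hπd := hπj.mdifferentiable (by simp) q
  have hsd := hs.mdifferentiableAt hxU
  have h1 := A.form_mfderiv_smul hQ A.isTypeAd A.form_fundamentalVector hgd
    (MDifferentiableAt.comp (g := s) (f := fun y => π (j y)) q hsd hπd)
    (Filter.eventually_of_mem hqV hgs) ξ
  have h2 := B.form_mfderiv_smul hπ.smooth_action B.isTypeAd B.form_fundamentalVector (u := j)
    (a := fun y => ι (g y)) (t := fun y => j (s (π (j y))))
    ((hι.contMDiff.mdifferentiable (by simp) _).comp q hgd)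
    (MDifferentiableAt.comp (g := fun x => j (s x)) (f := fun y => π (j y)) q
      ((hj.isLocalSection_comp hs).mdifferentiableAt hxU) hπd)
    (Filter.eventually_of_mem hqV fun y hy =>
      (congrArg j (hgs y hy)).trans (hj.map_smul _ _)) ξ
  have h3 := mfderiv_comp_apply_eq (g := fun x => j (s x)) (y := π (j q))
    ((hj.isLocalSection_comp hs).mdifferentiableAt hxU) hπd rfl ξ
  have h4 := mfderiv_comp_apply_eq (g := s) (y := π (j q)) hsd hπd rfl ξ
  rw [h3, h U s hs _ hxU, one_smul, maurerCartan_comp_hom hι.contMDiff hgd, ← map_inv,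
    ← lieMap_Ad hι.contMDiff, ← map_add, ← h4] at h2
  rw [h2]
  rw [mfderiv_id, one_smul] at h1
  exact congrArg (lieMap (E := EH) ι) h1.symm

/-- Each connection on a reduction extends uniquely. -/
theorem IsReduction.existsUnique_extends [IsManifold 𝓘(ℝ, EM) ∞ M]
    (hπ : IsPrincipalBundle EP EH H EM π)
    (hι : Manifold.IsSmoothEmbedding 𝓘(ℝ, EG) 𝓘(ℝ, EH) ∞ ι) (hj : IsReduction EP EM EQ π ι j)
    (A : Connection EQ Q EG G) : ∃! B : Connection EP P EH H, Extends ι j A B := by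
  obtain ⟨α, hα, hα1, hαs⟩ := hj.exists_lieForm hπ hι 1
    (fun s x => (lieMap (E := EH) ι).comp ((A.form (s x)).comp (mfderiv 𝓘(ℝ, EM) 𝓘(ℝ, EQ) s x)))
    (fun U s hs => by
      have h1 := A.smooth.comp_contMDiffOn (contMDiffOn_tangentMap hs.isOpen hs.smooth)
      let Λ : EG →L[ℝ] EH := lieMap (E := EH) (EG := EG) ι
      exact Λ.contDiff.contMDiff.comp_contMDiffOn h1)
    (fun U s s' g hs hs' hg hgs x hx v => by
      have hgd := (hg.contMDiffAt (hs.isOpen.mem_nhds hx)).mdifferentiableAt (by simp)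
      have h1 := A.form_mfderiv_smul (hj.contMDiff_smul hπ.smooth_action hι.contMDiff) A.isTypeAd
        A.form_fundamentalVector hgd (hs.mdifferentiableAt hx)
        (Filter.eventually_of_mem (hs.isOpen.mem_nhds hx) hgs) v
      refine (congrArg (lieMap (E := EH) ι) h1).trans ?_
      rw [one_smul, one_smul, map_add, lieMap_Ad hι.contMDiff, map_inv,
        maurerCartan_comp_hom hι.contMDiff hgd]
      rfl)
  refine ⟨{ α with
      isTypeAd := hα
      apply_fundamentalVector := fun X p => (hα1 X p).trans (one_smul ℝ X) },
    hj.extends_of_section hπ hι hαs, fun B hB => ?_⟩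
  have h1 := hj.lieForm_ext hπ B.isTypeAd hα B.form_fundamentalVector hα1 fun U s hs x hx v => by
    rw [hαs U s hs x hx v, hj.mfderiv_section hs hx]
    exact hB _ _
  exact Connection.ext_form fun p v => by rw [h1]

/-- The projection of the restriction of a connection is a connection. -/
theorem IsInvariantSubmanifold.existsUnique_isProjectedRestriction [FiniteDimensional ℝ EH]
    (hP : ContMDiff (𝓘(ℝ, EP).prod 𝓘(ℝ, EH)) 𝓘(ℝ, EP) ∞ (fun z : P × H => op z.2 • z.1))
    (hι : Manifold.IsSmoothEmbedding 𝓘(ℝ, EG) 𝓘(ℝ, EH) ∞ ι)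
    (hj : IsInvariantSubmanifold EP EQ ι j)
    (𝔪 : Submodule ℝ (GroupLieAlgebra 𝓘(ℝ, EH) H))
    (h𝔪 : IsCompl (lieSubspace (E := EH) (EG := EG) ι) 𝔪)
    (h𝔪G : ∀ g : G, ∀ X ∈ 𝔪, Ad (E := EH) (ι g) X ∈ 𝔪) (B : Connection EP P EH H) :
    ∃! A : Connection EQ Q EG G, IsProjectedRestriction ι 𝔪 h𝔪 j B A := by
  have hinj : Function.Injective (lieMap (E := EH) (EG := EG) ι) := mfderiv_embedding_injective hι 1
  have hQ := hj.contMDiff_smul hP hι.contMDiff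
  have hjd := hj.embedding.contMDiff.mdifferentiable (n := ∞) (by simp)
  -- A left inverse of `𝔤 → 𝔥` makes `pr_𝔤` a map `L` into the Lie algebra of `G` itself; finite
  -- dimension of `𝔥` makes `L` continuous.
  obtain ⟨r, hr⟩ := (lieMap (E := EH) (EG := EG) ι).toLinearMap.exists_leftInverse_of_injective
    (LinearMap.ker_eq_bot.2 hinj)
  let L : EH →L[ℝ] EG := LinearMap.toContinuousLinearMap
    (r ∘ₗ (lieSubspace (E := EH) (EG := EG) ι).projection 𝔪 h𝔪 : EH →ₗ[ℝ] EG)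
  have hL : ∀ X : GroupLieAlgebra 𝓘(ℝ, EH) H, lieMap (E := EH) (EG := EG) ι (L X) =
      (lieSubspace (E := EH) (EG := EG) ι).projection 𝔪 h𝔪 X := by
    intro X
    obtain ⟨Y, hY⟩ := Submodule.projection_apply_mem h𝔪 X
    have h1 : L X = Y := (congrArg r hY.symm).trans (LinearMap.congr_fun hr Y)
    rw [h1]
    exact hY
  let F : ∀ q : Q, TangentSpace 𝓘(ℝ, EQ) q →L[ℝ] GroupLieAlgebra 𝓘(ℝ, EG) G := fun q =>
    L.comp ((B.form (j q)).comp (mfderiv 𝓘(ℝ, EQ) 𝓘(ℝ, EP) j q))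
  have hF : ∀ q (ξ : TangentSpace 𝓘(ℝ, EQ) q), lieMap (E := EH) (EG := EG) ι (F q ξ) =
      (lieSubspace (E := EH) (EG := EG) ι).projection 𝔪 h𝔪
        (B.form (j q) (mfderiv 𝓘(ℝ, EQ) 𝓘(ℝ, EP) j q ξ)) := fun q ξ => hL _
  have hform : ∀ p p', p = p' → ∀ w : EP, (B.form p w : EH) = B.form p' w := by
    rintro p _ rfl w; rfl
  refine ⟨⟨⟨F, ?_⟩, fun g q ξ => hinj ?_, fun X q => hinj ?_⟩, hF, fun A hA =>
    Connection.ext_form fun q ξ => hinj ((hA q ξ).trans (hF q ξ).symm)⟩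
  · have _ : IsManifold 𝓘(ℝ, EP) 1 P := .of_le (n := ∞) (by simp)
    have _ : IsManifold 𝓘(ℝ, EQ) 1 Q := .of_le (n := ∞) (by simp)
    exact L.contDiff.contMDiff.comp
      (B.smooth.comp (hj.embedding.contMDiff.contMDiff_tangentMap (m := ∞) (by simp)))
  · have h1 := mfderiv_comp_apply_eq (g := j) (y := op g • q) (hjd _)
      ((contMDiff_smul_left hQ g).mdifferentiable (by simp) q) rfl ξ
    have h2 := mfderiv_comp_apply_eq (g := fun p : P => op (ι g) • p) (y := j q)
      ((contMDiff_smul_left hP (ι g)).mdifferentiable (by simp) _) (hjd q) rfl ξ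
    rw [funext (hj.map_smul g)] at h1
    have h3 : B.form (j (op g • q)) (mfderiv 𝓘(ℝ, EQ) 𝓘(ℝ, EP) j (op g • q) (rightDeriv g q ξ)) =
        Ad (E := EH) (ι g)⁻¹ (B.form (j q) (mfderiv 𝓘(ℝ, EQ) 𝓘(ℝ, EP) j q ξ)) :=
      (hform _ _ (hj.map_smul g q) _).trans
        ((congrArg (B.form (op (ι g) • j q)) (h1.symm.trans h2)).trans (B.isTypeAd _ _ _))
    rw [lieMap_Ad hι.contMDiff]
    change lieMap (E := EH) (EG := EG) ι (F _ _) = Ad (E := EH) _ (lieMap (E := EH) (EG := EG) ι (F _ _))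
    rw [hF, hF, h3, map_inv]
    refine projection_apply_of_invariant h𝔪 (T := (Ad (E := EH) (ι g)⁻¹).toLinearMap) ?_ ?_ _
    · exact fun X hX => Ad_mem_lieSubspace hι (inv_mem (mem_normalizer_range ι g)) hX
    · intro X hX
      rw [← map_inv]
      exact h𝔪G _ _ hX
  · have h1 := mfderiv_comp_apply_eq (g := j) (y := q) (hjd _)
      ((contMDiff_smul_right hQ q).mdifferentiable (by simp) (1 : G)) (by simp) X
    have h2 := mfderiv_comp_apply_eq (g := fun a : H => op a • j q) (y := 1)
      ((contMDiff_smul_right hP (j q)).mdifferentiable (by simp) _)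
      (hι.contMDiff.mdifferentiable (by simp) 1) (by simp) X
    rw [funext fun g => hj.map_smul g q] at h1
    change lieMap (E := EH) (EG := EG) ι (F _ _) = _
    rw [hF]
    have h3 : B.form (j q) (mfderiv 𝓘(ℝ, EQ) 𝓘(ℝ, EP) j q (fundamentalVector X q)) =
        lieMap (E := EH) (EG := EG) ι X :=
      (congrArg (B.form (j q)) (h1.symm.trans h2)).trans (B.apply_fundamentalVector _ _)
    rw [h3]
    exact Submodule.projection_apply_of_mem_left h𝔪 ⟨X, rfl⟩

end Connections

/-! ### Deformation by a map into the normaliser -/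

section Deformation

variable {EM : Type*} [NormedAddCommGroup EM] [NormedSpace ℝ EM]
  {M : Type*} [TopologicalSpace M] [ChartedSpace EM M] [IsManifold 𝓘(ℝ, EM) ∞ M]
  {EH : Type*} [NormedAddCommGroup EH] [NormedSpace ℝ EH]
  {H : Type*} [TopologicalSpace H] [ChartedSpace EH H] [Group H] [LieGroup 𝓘(ℝ, EH) ∞ H]
  {EG : Type*} [NormedAddCommGroup EG] [NormedSpace ℝ EG]
  {G : Type*} [TopologicalSpace G] [ChartedSpace EG G] [Group G] [LieGroup 𝓘(ℝ, EG) ∞ G]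
  {EP : Type*} [NormedAddCommGroup EP] [NormedSpace ℝ EP]
  {P : Type*} [TopologicalSpace P] [ChartedSpace EP P] [IsManifold 𝓘(ℝ, EP) ∞ P]
  [MulAction Hᵐᵒᵖ P]
  {EQ : Type*} [NormedAddCommGroup EQ] [NormedSpace ℝ EQ]
  {Q : Type*} [TopologicalSpace Q] [ChartedSpace EQ Q] [IsManifold 𝓘(ℝ, EQ) ∞ Q]
  [MulAction Gᵐᵒᵖ Q]
  {EQ' : Type*} [NormedAddCommGroup EQ'] [NormedSpace ℝ EQ']
  {Q' : Type*} [TopologicalSpace Q'] [ChartedSpace EQ' Q'] [IsManifold 𝓘(ℝ, EQ') ∞ Q']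
  [MulAction Gᵐᵒᵖ Q']
  {π : P → M} {ι : G →* H} {j : Q → P} {j' : Q' → P} {h : M → H}

omit [IsManifold 𝓘(ℝ, EM) ∞ M] [LieGroup 𝓘(ℝ, EH) ∞ H] [IsManifold 𝓘(ℝ, EP) ∞ P] in
theorem deform_deform_inv (hπ : IsPrincipalBundle EP EH H EM π) (h : M → H) (p : P) :
    deform π (fun x => (h x)⁻¹) (deform π h p) = p := by
  unfold deform
  rw [hπ.proj_smul, smul_smul, ← op_mul, mul_inv_cancel, op_one, one_smul]

-- Smoothness into the embedded `Q'` is checked in `P`. No normaliser condition enters, so the lemma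
-- also applies with `h⁻¹` and with `Q`, `Q'` exchanged.
omit [LieGroup 𝓘(ℝ, EH) ∞ H] [TopologicalSpace G] [IsManifold 𝓘(ℝ, EQ) ∞ Q] in
theorem isLocalSection_deform (hπ : IsPrincipalBundle EP EH H EM π)
    (hj : IsInvariantSubmanifold EP EQ ι j) (hj' : IsInvariantSubmanifold EP EQ' ι j')
    (hh : ContMDiff 𝓘(ℝ, EM) 𝓘(ℝ, EH) ∞ h) {U : Set M} {s : M → Q} {s' : M → Q'}
    (hs : IsLocalSection EM EQ (fun q => π (j q)) U s)
    (hss' : ∀ x ∈ U, j' (s' x) = deform π h (j (s x))) :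
    IsLocalSection EM EQ' (fun q => π (j' q)) U s' := by
  refine ⟨hs.isOpen, fun x hx => ContMDiffAt.contMDiffWithinAt ?_, fun x hx => ?_⟩
  · refine contMDiffAt_of_comp_embedding hj'.embedding ?_
    have h1 : ContMDiffAt 𝓘(ℝ, EM) 𝓘(ℝ, EP) ∞ (fun y => op (h y) • j (s y)) x :=
      hπ.smooth_action.contMDiffAt.comp x
        (((hj.isLocalSection_comp hs).contMDiffAt hx).prodMk (hh x))
    refine h1.congr_of_eventuallyEq (Filter.eventually_of_mem (hs.isOpen.mem_nhds hx) fun y hy => ?_)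
    exact (hss' y hy).trans (by rw [deform, hs.proj y hy])
  · rw [hss' x hx, deform, hπ.proj_smul, hs.proj x hx]

omit [IsManifold 𝓘(ℝ, EM) ∞ M] [TopologicalSpace G] [IsManifold 𝓘(ℝ, EQ) ∞ Q]
  [TopologicalSpace Q'] [MulAction Gᵐᵒᵖ Q'] in
/-- A connection along the deformation of a local section. -/
theorem Connection.form_deform (hπ : IsPrincipalBundle EP EH H EM π)
    (hj : IsInvariantSubmanifold EP EQ ι j) (hh : ContMDiff 𝓘(ℝ, EM) 𝓘(ℝ, EH) ∞ h) {U : Set M}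
    {s : M → Q} {s' : M → Q'} (hs : IsLocalSection EM EQ (fun q => π (j q)) U s)
    (hss' : ∀ x ∈ U, j' (s' x) = deform π h (j (s x))) (B : Connection EP P EH H) {x : M}
    (hx : x ∈ U) (v : TangentSpace 𝓘(ℝ, EM) x) :
    B.form (j' (s' x)) (mfderiv 𝓘(ℝ, EM) 𝓘(ℝ, EP) (fun y => j' (s' y)) x v) =
      Ad (E := EH) (h x)⁻¹
          (B.form (j (s x)) (mfderiv 𝓘(ℝ, EM) 𝓘(ℝ, EP) (fun y => j (s y)) x v)) +
        maurerCartan (h x) (mfderiv 𝓘(ℝ, EM) 𝓘(ℝ, EH) h x v) := by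
  have h1 := B.form_mfderiv_smul hπ.smooth_action B.isTypeAd B.form_fundamentalVector
    (u := fun y => j' (s' y)) (hh.mdifferentiable (by simp) x)
    ((hj.isLocalSection_comp hs).mdifferentiableAt hx)
    (Filter.eventually_of_mem (hs.isOpen.mem_nhds hx) fun y hy =>
      (hss' y hy).trans (by rw [deform, hs.proj y hy])) v
  rw [one_smul] at h1
  exact h1

omit [LieGroup 𝓘(ℝ, EH) ∞ H] [TopologicalSpace G] [IsManifold 𝓘(ℝ, EQ) ∞ Q] in
/-- The deformation of a reduction by a map into the normaliser is a reduction. -/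
theorem IsReduction.of_deform (hπ : IsPrincipalBundle EP EH H EM π) (hj : IsReduction EP EM EQ π ι j)
    (hj' : IsInvariantSubmanifold EP EQ' ι j') (hh : ContMDiff 𝓘(ℝ, EM) 𝓘(ℝ, EH) ∞ h)
    (hN : ∀ x, h x ∈ Subgroup.normalizer (ι.range : Set H))
    (hQ' : Set.range j' = deform π h '' Set.range j) : IsReduction EP EM EQ' π ι j' := by
  have hlift : ∀ q, ∃ q', j' q' = deform π h (j q) := fun q => by
    have : deform π h (j q) ∈ Set.range j' := hQ' ▸ ⟨_, ⟨q, rfl⟩, rfl⟩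
    exact this
  have hlift' : ∀ q', ∃ q, deform π h (j q) = j' q' := fun q' => by
    have : j' q' ∈ deform π h '' Set.range j := hQ' ▸ ⟨q', rfl⟩
    obtain ⟨_, ⟨q, rfl⟩, hq⟩ := this
    exact ⟨q, hq⟩
  refine { hj' with exists_isLocalSection := fun x => ?_, exists_smul := fun q₁ q₂ hq => ?_ }
  · obtain ⟨U, s, hx, hs⟩ := hj.exists_isLocalSection x
    choose s' hs' using fun y => hlift (s y)
    exact ⟨U, s', hx, isLocalSection_deform hπ hj.toIsInvariantSubmanifold hj' hh hs
      fun y _ => hs' y⟩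
  · obtain ⟨r₁, h1⟩ := hlift' q₁
    obtain ⟨r₂, h2⟩ := hlift' q₂
    rw [← h1, ← h2, deform, deform, hπ.proj_smul,
      hπ.proj_smul] at hq
    obtain ⟨g, rfl⟩ := hj.exists_smul r₁ r₂ hq
    -- Points of `Q` differing by `g` have deformations differing by `h⁻¹ g h`, with the same `h`
    -- since they lie in one fibre.
    obtain ⟨g', hg'⟩ := (Subgroup.mem_normalizer_iff.1 (inv_mem (hN (π (j r₁)))) (ι g)).1 ⟨g, rfl⟩
    refine ⟨g', hj'.embedding.isEmbedding.injective ?_⟩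
    rw [hj'.map_smul, ← h1, ← h2, deform, deform, ← hq,
      hj.map_smul, smul_smul, smul_smul, ← op_mul, ← op_mul, hg']
    congr 2
    group

omit [IsManifold 𝓘(ℝ, EQ') ∞ Q'] in
/-- The deformation form. -/
theorem IsReduction.exists_isDeformationForm [FiniteDimensional ℝ EH]
    (hπ : IsPrincipalBundle EP EH H EM π)
    (hι : Manifold.IsSmoothEmbedding 𝓘(ℝ, EG) 𝓘(ℝ, EH) ∞ ι)
    (𝔪 : Submodule ℝ (GroupLieAlgebra 𝓘(ℝ, EH) H))
    (h𝔪 : IsCompl (lieSubspace (E := EH) (EG := EG) ι) 𝔪)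
    (h𝔪G : ∀ g : G, ∀ X ∈ 𝔪, Ad (E := EH) (ι g) X ∈ 𝔪)
    (hh : ContMDiff 𝓘(ℝ, EM) 𝓘(ℝ, EH) ∞ h)
    (hN : ∀ x, h x ∈ Subgroup.normalizer (ι.range : Set H))
    (hj' : IsReduction EP EM EQ' π ι j') :
    ∃ ζ : LieForm EP P EH H,
      (∀ (X : GroupLieAlgebra 𝓘(ℝ, EH) H) (p : P), ζ.form p (fundamentalVector X p) = (0 : ℝ) • X) ∧
      ∀ α : LieForm EP P EH H,
        IsDeformationForm EQ' EM π h j' (lieSubspace (E := EH) (EG := EG) ι) 𝔪 h𝔪 α ↔ α = ζ := by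
  let pr : EH →L[ℝ] EH := LinearMap.toContinuousLinearMap
    (𝔪.projection _ h𝔪.symm : EH →ₗ[ℝ] EH)
  let θ : ∀ x : M, TangentSpace 𝓘(ℝ, EM) x →L[ℝ] GroupLieAlgebra 𝓘(ℝ, EH) H := fun x =>
    pr.comp ((maurerCartan (h x)).comp (mfderiv 𝓘(ℝ, EM) 𝓘(ℝ, EH) h x))
  have hθ : ContMDiff 𝓘(ℝ, EM).tangent 𝓘(ℝ, EH) (M' := EH) ∞
      (fun v : TangentBundle 𝓘(ℝ, EM) M => (θ v.1 v.2 : EH)) := by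
    have _ : IsManifold 𝓘(ℝ, EM) 1 M := .of_le (n := ∞) (by simp)
    have _ : IsManifold 𝓘(ℝ, EH) 1 H := .of_le (n := ∞) (by simp)
    exact pr.contDiff.contMDiff.comp
      (contMDiff_maurerCartan.comp (hh.contMDiff_tangentMap (m := ∞) (by simp)))
  -- This invariance is exactly the gluing condition with `c = 0` for one `θ` serving all sections.
  have hAd : ∀ (g : G) (x : M) (v : TangentSpace 𝓘(ℝ, EM) x),
      Ad (E := EH) (ι g)⁻¹ (θ x v) = θ x v := by
    intro g x v
    have h1 := projection_apply_of_invariant h𝔪.symm (T := (Ad (E := EH) (ι g)⁻¹).toLinearMap)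
      (fun X hX => by rw [← map_inv]; exact h𝔪G _ _ hX)
      (fun X hX => Ad_mem_lieSubspace hι (inv_mem (mem_normalizer_range ι g)) hX)
      (maurerCartan (h x) (mfderiv 𝓘(ℝ, EM) 𝓘(ℝ, EH) h x v))
    have h2 := (Submodule.projection_apply_eq_zero_iff h𝔪.symm).2
      (Ad_maurerCartan_sub_mem hι hh hN g x v)
    rw [map_sub, sub_eq_zero] at h2
    exact h1.symm.trans h2
  obtain ⟨ζ, hζ, hζ0, hζs⟩ := hj'.exists_lieForm hπ hι 0 (fun _ => θ) (fun _ _ _ => hθ.contMDiffOn)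
    (fun U s s' g _ _ _ _ x _ v => by rw [zero_smul, add_zero, hAd])
  refine ⟨ζ, hζ0, fun α => ⟨fun hα => ?_, ?_⟩⟩
  · refine hj'.lieForm_ext hπ hα.isTypeAd hζ (fun X p => ?_) hζ0 fun U s hs x hx v => ?_
    · rw [zero_smul]
      exact hα.isHorizontal p _ (hπ.mfderiv_proj_fundamentalVector X p)
    · rw [hζs U s hs x hx v]
      exact hα.localRep U s hs x hx v
  · rintro rfl
    refine ⟨fun p v hv => ?_, hζ, hζs⟩
    -- With `c = 0` the local formula depends on `v` only through `dπ(v)`.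
    obtain ⟨U, s, hx, hs⟩ := hj'.exists_isLocalSection (π p)
    rw [α.form_eq_localForm hπ hζ hζ0 (hj'.isLocalSection_comp hs) hx, localForm_apply, hv,
      zero_smul, map_zero, map_zero, add_zero]

end Deformation

end NormalDeformation

end

/-! ### The main theorem -/

open NormalDeformation in
theorem mainTheorem4
    -- the base manifold `M`, the Lie groups `G ⊆ H`, and the manifolds `P`, `Q`, `Q'`
    {EM : Type*} [NormedAddCommGroup EM] [NormedSpace ℝ EM] [FiniteDimensional ℝ EM]
    {M : Type*} [TopologicalSpace M] [ChartedSpace EM M] [IsManifold 𝓘(ℝ, EM) ∞ M]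
    {EH : Type*} [NormedAddCommGroup EH] [NormedSpace ℝ EH] [FiniteDimensional ℝ EH]
    {H : Type*} [TopologicalSpace H] [ChartedSpace EH H] [Group H] [LieGroup 𝓘(ℝ, EH) ∞ H]
    {EG : Type*} [NormedAddCommGroup EG] [NormedSpace ℝ EG] [FiniteDimensional ℝ EG]
    {G : Type*} [TopologicalSpace G] [ChartedSpace EG G] [Group G] [LieGroup 𝓘(ℝ, EG) ∞ G]
    {EP : Type*} [NormedAddCommGroup EP] [NormedSpace ℝ EP] [FiniteDimensional ℝ EP]
    {P : Type*} [TopologicalSpace P] [ChartedSpace EP P] [IsManifold 𝓘(ℝ, EP) ∞ P]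
    [MulAction Hᵐᵒᵖ P]
    {EQ : Type*} [NormedAddCommGroup EQ] [NormedSpace ℝ EQ] [FiniteDimensional ℝ EQ]
    {Q : Type*} [TopologicalSpace Q] [ChartedSpace EQ Q] [IsManifold 𝓘(ℝ, EQ) ∞ Q]
    [MulAction Gᵐᵒᵖ Q]
    {EQ' : Type*} [NormedAddCommGroup EQ'] [NormedSpace ℝ EQ'] [FiniteDimensional ℝ EQ']
    {Q' : Type*} [TopologicalSpace Q'] [ChartedSpace EQ' Q'] [IsManifold 𝓘(ℝ, EQ') ∞ Q']
    [MulAction Gᵐᵒᵖ Q']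
    -- `(P, π, M, H)` is a principal bundle
    (π : P → M) (hπ : IsPrincipalBundle EP EH H EM π)
    -- `G` is a Lie subgroup of `H`
    (ι : G →* H) (hι : Manifold.IsSmoothEmbedding 𝓘(ℝ, EG) 𝓘(ℝ, EH) ∞ ι)
    -- `Q` is a principal `G`-subbundle of `P`
    (j : Q → P) (hj : IsPrincipalSubbundle EP EM EQ EG π ι j)
    -- `𝔥 = 𝔤 ⊕ 𝔪` is a `G`-invariant splitting
    (𝔪 : Submodule ℝ (GroupLieAlgebra 𝓘(ℝ, EH) H))
    (h𝔪 : IsCompl (lieSubspace (E := EH) (EG := EG) ι) 𝔪)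
    (h𝔪G : ∀ g : G, ∀ X ∈ 𝔪, Ad (E := EH) (ι g) X ∈ 𝔪)
    -- `h` is a smooth map from `M` to the normaliser of `G` in `H`
    (h : M → H) (hh : ContMDiff 𝓘(ℝ, EM) 𝓘(ℝ, EH) ∞ h)
    (hN : ∀ x, h x ∈ Subgroup.normalizer (ι.range : Set H))
    -- `Q'` is the submanifold `𝓡_h(Q)` of `P` with the restricted right action of `G`
    (j' : Q' → P) (hj' : IsInvariantSubmanifold EP EQ' ι j')
    (hQ' : Set.range j' = deform π h '' Set.range j) :
    -- the extension maps of `Q` and `Q'`, the bijection `f_{Q,h}`, and the form `ζ_h`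
    ∃ (fhat : Connection EQ Q EG G → Connection EP P EH H)
      (fhat' : Connection EQ' Q' EG G → Connection EP P EH H)
      (f : Connection EQ Q EG G → Connection EQ' Q' EG G)
      (ζ : LieForm EP P EH H),
      (∀ A B, Extends ι j A B ↔ B = fhat A) ∧
      (∀ A' B, Extends ι j' A' B ↔ B = fhat' A') ∧
      (∀ A A', IsProjectedRestriction ι 𝔪 h𝔪 j' (fhat A) A' ↔ A' = f A) ∧
      Function.Bijective f ∧
      (∀ α : LieForm EP P EH H,
        IsDeformationForm EQ' EM π h j' (lieSubspace (E := EH) (EG := EG) ι) 𝔪 h𝔪 α ↔ α = ζ) ∧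
      (∀ (A : Connection EQ Q EG G) (p : P) (v : TangentSpace 𝓘(ℝ, EP) p),
        (fhat A).form p v - (fhat' (f A)).form p v = ζ.form p v) ∧
      -- the local representation of `f_{Q,h}(A)` along `s' = 𝓡_h ∘ s`
      (∀ (A : Connection EQ Q EG G) (U : Set M) (s : M → Q) (s' : M → Q'),
        IsLocalSection EM EQ (fun q => π (j q)) U s →
        (∀ x ∈ U, j' (s' x) = deform π h (j (s x))) →
        IsLocalSection EM EQ' (fun q => π (j' q)) U s' ∧
        ∀ x ∈ U, ∀ v : TangentSpace 𝓘(ℝ, EM) x,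
          lieMap (E := EH) (EG := EG) ι
              ((f A).form (s' x) (mfderiv 𝓘(ℝ, EM) 𝓘(ℝ, EQ') s' x v)) =
            Ad (E := EH) (h x)⁻¹
                (lieMap (E := EH) (EG := EG) ι
                  (A.form (s x) (mfderiv 𝓘(ℝ, EM) 𝓘(ℝ, EQ) s x v))) +
              Submodule.projection (lieSubspace (E := EH) (EG := EG) ι) 𝔪 h𝔪
                (maurerCartan (h x) (mfderiv 𝓘(ℝ, EM) 𝓘(ℝ, EH) h x v))) := by
  have hjr := hj.isReduction
  have hjr' := hjr.of_deform hπ hj' hh hN hQ'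
  choose fhat hfhat hfhat_unique using hjr.existsUnique_extends hπ hι (EG := EG)
  choose fhat' hfhat' hfhat'_unique using hjr'.existsUnique_extends hπ hι (EG := EG)
  choose r hr hr_unique using fun B : Connection EP P EH H =>
    hjr.existsUnique_isProjectedRestriction hπ.smooth_action hι 𝔪 h𝔪 h𝔪G B
  choose r' hr' hr'_unique using fun B : Connection EP P EH H =>
    hjr'.existsUnique_isProjectedRestriction hπ.smooth_action hι 𝔪 h𝔪 h𝔪G B
  obtain ⟨ζ, hζ0, hζ⟩ := hjr'.exists_isDeformationForm hπ hι 𝔪 h𝔪 h𝔪G hh hN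
  have hζd := (hζ ζ).2 rfl
  have hinj : Function.Injective (lieMap (E := EH) (EG := EG) ι) := mfderiv_embedding_injective hι 1
  have hlift : ∀ q, ∃ q', j' q' = deform π h (j q) := fun q => by
    have : deform π h (j q) ∈ Set.range j' := hQ' ▸ ⟨_, ⟨q, rfl⟩, rfl⟩
    exact this
  have hlift' : ∀ q', ∃ q, deform π h (j q) = j' q' := fun q' => by
    have : j' q' ∈ deform π h '' Set.range j := hQ' ▸ ⟨q', rfl⟩
    obtain ⟨_, ⟨q, rfl⟩, hq⟩ := this
    exact ⟨q, hq⟩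
  have hmem : ∀ (a : H), a ∈ Subgroup.normalizer (ι.range : Set H) → ∀ X,
      Ad (E := EH) a (lieMap (E := EH) (EG := EG) ι X) ∈ lieSubspace (E := EH) (EG := EG) ι :=
    fun a ha X => Ad_mem_lieSubspace hι ha ⟨X, rfl⟩
  -- the extension of a connection on `Q` along the deformation of a local section
  have hdef : ∀ (A : Connection EQ Q EG G) (U : Set M) (s : M → Q) (s' : M → Q'),
      IsLocalSection EM EQ (fun q => π (j q)) U s →
      (∀ x ∈ U, j' (s' x) = deform π h (j (s x))) → ∀ x ∈ U, ∀ v : TangentSpace 𝓘(ℝ, EM) x,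
      (fhat A).form (j' (s' x)) (mfderiv 𝓘(ℝ, EM) 𝓘(ℝ, EP) (fun y => j' (s' y)) x v) =
        Ad (E := EH) (h x)⁻¹
            (lieMap (E := EH) ι (A.form (s x) (mfderiv 𝓘(ℝ, EM) 𝓘(ℝ, EQ) s x v))) +
          maurerCartan (h x) (mfderiv 𝓘(ℝ, EM) 𝓘(ℝ, EH) h x v) := by
    intro A U s s' hs hss' x hx v
    rw [(fhat A).form_deform hπ hjr.toIsInvariantSubmanifold hh hs hss' hx v,
      hjr.mfderiv_section hs hx v, hfhat A (s x)]
  have hrest : ∀ (B : Connection EP P EH H) (U : Set M) (s' : M → Q'),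
      IsLocalSection EM EQ' (fun q => π (j' q)) U s' → ∀ x ∈ U, ∀ v : TangentSpace 𝓘(ℝ, EM) x,
      lieMap (E := EH) ι ((r' B).form (s' x) (mfderiv 𝓘(ℝ, EM) 𝓘(ℝ, EQ') s' x v)) =
        Submodule.projection (lieSubspace (E := EH) (EG := EG) ι) 𝔪 h𝔪
          (B.form (j' (s' x)) (mfderiv 𝓘(ℝ, EM) 𝓘(ℝ, EP) (fun y => j' (s' y)) x v)) := by
    intro B U s' hs' x hx v
    rw [hjr'.mfderiv_section hs' hx v]
    exact hr' B _ _
  have hdiff : ∀ A : Connection EQ Q EG G, fhat A =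
      (fhat' (r' (fhat A))).add ζ hζd.isTypeAd hζ0 := by
    intro A
    set B := (fhat' (r' (fhat A))).add ζ hζd.isTypeAd hζ0 with hB
    have : (fhat A).toLieForm = B.toLieForm := by
      refine hjr'.lieForm_ext hπ (fhat A).isTypeAd B.isTypeAd (fhat A).form_fundamentalVector
        B.form_fundamentalVector fun U s' hs' x hx v => ?_
      -- Deforming by `h⁻¹` carries the given section of `Q'` back to a section of `Q`, so that
      -- `hdef` applies.
      choose s hs using fun y => hlift' (s' y)
      have hsl := isLocalSection_deform hπ hj' hjr.toIsInvariantSubmanifold (s' := s) hh.inv hs'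
        fun y _ => by rw [← hs y]; exact (deform_deform_inv hπ h _).symm
      have h1 := hdef A U s s' hsl (fun y _ => (hs y).symm) x hx v
      have h2 := hrest (fhat A) U s' hs' x hx v
      have h3 := hfhat' (r' (fhat A)) (s' x) (mfderiv 𝓘(ℝ, EM) 𝓘(ℝ, EQ') s' x v)
      rw [← hjr'.mfderiv_section hs' hx v, h2] at h3
      have h4 := hζd.localRep U s' hs' x hx v
      have h5 : B.form (j' (s' x)) (mfderiv 𝓘(ℝ, EM) 𝓘(ℝ, EP) (fun y => j' (s' y)) x v) =
          (fhat' (r' (fhat A))).form (j' (s' x))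
            (mfderiv 𝓘(ℝ, EM) 𝓘(ℝ, EP) (fun y => j' (s' y)) x v) +
          ζ.form (j' (s' x)) (mfderiv 𝓘(ℝ, EM) 𝓘(ℝ, EP) (fun y => j' (s' y)) x v) := rfl
      -- The `A` term lies in `𝔤` and is fixed by `pr_𝔤`; the two projections of the Maurer-Cartan
      -- term add up to it.
      rw [h5, h3, h4, h1, map_add, add_assoc, Submodule.projection_add_projection_eq_self,
        Submodule.projection_apply_of_mem_left h𝔪 (hmem _ (inv_mem (hN x)) _)]
    exact Connection.ext_form fun p v => by rw [this]
  refine ⟨fhat, fhat', fun A => r' (fhat A), ζ,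
    fun A B => ⟨hfhat_unique A B, fun hB => hB ▸ hfhat A⟩,
    fun A B => ⟨hfhat'_unique A B, fun hB => hB ▸ hfhat' A⟩,
    fun A A' => ⟨hr'_unique _ A', fun hA => hA ▸ hr' _⟩, ⟨?_, ?_⟩, hζ, ?_, ?_⟩
  · intro A₁ A₂ hA
    have hA' : r' (fhat A₁) = r' (fhat A₂) := hA
    have h1 : fhat A₁ = fhat A₂ := by rw [hdiff A₁, hdiff A₂, hA']
    exact Connection.ext_form fun q ξ => hinj
      ((hfhat A₁ q ξ).symm.trans ((congrArg (fun B : Connection EP P EH H =>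
        B.form (j q) (mfderiv 𝓘(ℝ, EQ) 𝓘(ℝ, EP) j q ξ)) h1).trans (hfhat A₂ q ξ)))
  · intro A'
    set B := (fhat' A').add ζ hζd.isTypeAd hζ0 with hB
    -- `B` is the extension of its own projected restriction to `Q`, because along sections of `Q`
    -- it already takes values in `𝔤`.
    have hBA : B = fhat (r B) := by
      refine hfhat_unique _ _ (hjr.extends_of_section hπ hι fun U s hs x hx v => ?_)
      choose s' hs' using fun y => hlift (s y)
      have hsl := isLocalSection_deform hπ hjr.toIsInvariantSubmanifold hj' (s' := s') hh hs
        fun y _ => hs' y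
      have h1 := B.form_deform hπ hjr.toIsInvariantSubmanifold hh hs (fun y _ => hs' y) hx v
      have h3 := hfhat' A' (s' x) (mfderiv 𝓘(ℝ, EM) 𝓘(ℝ, EQ') s' x v)
      rw [← hjr'.mfderiv_section hsl hx v] at h3
      have h4 := hζd.localRep U s' hsl x hx v
      have h5 : B.form (j' (s' x)) (mfderiv 𝓘(ℝ, EM) 𝓘(ℝ, EP) (fun y => j' (s' y)) x v) =
          (fhat' A').form (j' (s' x)) (mfderiv 𝓘(ℝ, EM) 𝓘(ℝ, EP) (fun y => j' (s' y)) x v) +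
          ζ.form (j' (s' x)) (mfderiv 𝓘(ℝ, EM) 𝓘(ℝ, EP) (fun y => j' (s' y)) x v) := rfl
      rw [h5, h3, h4, Submodule.projection_eq_self_sub_projection h𝔪] at h1
      set b := B.form (j (s x)) (mfderiv 𝓘(ℝ, EM) 𝓘(ℝ, EP) (fun y => j (s y)) x v) with hb
      set μ := maurerCartan (E := EH) (h x) (mfderiv 𝓘(ℝ, EM) 𝓘(ℝ, EH) h x v)
      -- Equating `A' + pr_𝔪 μ` with `Ad(h⁻¹) b + μ` cancels the `𝔪`-part, so `Ad(h⁻¹) b`, and hence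
      -- `b`, lies in `𝔤`.
      have h6 : Ad (E := EH) (h x)⁻¹ b =
          lieMap (E := EH) ι (A'.form (s' x) (mfderiv 𝓘(ℝ, EM) 𝓘(ℝ, EQ') s' x v)) -
            Submodule.projection (lieSubspace (E := EH) (EG := EG) ι) 𝔪 h𝔪 μ := by
        rw [eq_sub_of_add_eq h1.symm]
        abel
      have h7 : b ∈ lieSubspace (E := EH) (EG := EG) ι := by
        rw [← Ad_Ad_inv (E := EH) (h x) b, h6]
        exact Ad_mem_lieSubspace hι (hN x)
          (Submodule.sub_mem _ ⟨_, rfl⟩ (Submodule.projection_apply_mem h𝔪 _))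
      have h8 := hr B (s x) (mfderiv 𝓘(ℝ, EM) 𝓘(ℝ, EQ) s x v)
      rw [← hjr.mfderiv_section hs hx v, ← hb, Submodule.projection_apply_of_mem_left h𝔪 h7] at h8
      exact h8.symm
    refine ⟨r B, Connection.ext_form fun q ξ => hinj ?_⟩
    -- `B` is now both `fhat' A' + ζ` and `fhat' (r' B) + ζ`; cancelling `ζ` and restricting to `Q'`
    -- gives `r' B = A'`.
    have h1 := hdiff (r B)
    rw [← hBA] at h1
    have h2 := congrArg (fun B : Connection EP P EH H =>
      B.form (j' q) (mfderiv 𝓘(ℝ, EQ') 𝓘(ℝ, EP) j' q ξ)) (hB.symm.trans h1)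
    have h3 : (fhat' A').form (j' q) (mfderiv 𝓘(ℝ, EQ') 𝓘(ℝ, EP) j' q ξ) =
        (fhat' (r' B)).form (j' q) (mfderiv 𝓘(ℝ, EQ') 𝓘(ℝ, EP) j' q ξ) := add_right_cancel h2
    rw [hfhat' A' q ξ, hfhat' (r' B) q ξ] at h3
    change lieMap (E := EH) ι ((r' (fhat (r B))).form q ξ) = _
    rw [← hBA]
    exact h3.symm
  · intro A p v
    have h1 : (fhat A).form p v = (fhat' (r' (fhat A))).form p v + ζ.form p v :=
      congrArg (fun B : Connection EP P EH H => B.form p v) (hdiff A)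
    rw [h1, add_sub_cancel_left]
  · intro A U s s' hs hss'
    have hs' := isLocalSection_deform hπ hjr.toIsInvariantSubmanifold hj' hh hs hss'
    refine ⟨hs', fun x hx v => ?_⟩
    rw [hrest _ U s' hs' x hx v, hdef A U s s' hs hss' x hx v, map_add,
      Submodule.projection_apply_of_mem_left h𝔪 (hmem _ (inv_mem (hN x)) _)]
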